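/- **Model.** An instance $I$ of election control by edge removal (ECER) or edge addition (ECEA) consists of: a finite non-empty set $V$ of voters; candidates $c_0,\dots,c_\ell$ with $\ell\ge 1$; injective score functions $\pi_v:\{0,\dots,\ell\}\to\mathbb N$ ($v\in V$); a set $S\subseteq V$ of seeds, each $s\in S$ with a message $m_s\in\mathbb Z^{\ell+1}$; a set $E\subseteq V\times V$ of edges; rational probabilities $p:V\times V\to[0,1]$; and a budget $B\in\mathbb N\cup\{\infty\}$. Let $H\subseteq V\times V$ be random, containing each pair $e$ independently with probability $p(e)$. If the edge set is $A$, the message $m_s$ spreads from $s$ along the edges of $A\cap H$ and influences all voters that it reaches ($s$ included). The final score of $c_i$ for $v$ is $(1-\epsilon)\pi_v(i)+\sum_s m_s(i)$, the sum being over the seeds whose message influences $v$, where $\epsilon=1/(1+\max_{v,i}\pi_v(i))$; every voter votes for the candidate with the highest final score. $\mathsf{MoV}(A,H)$ is the number of votes of $c_0$ minus the largest number of votes of another candidate. A feasible solution is a set $F\subseteq V\times V$ with $|F|\le B$ and $F\subseteq E$ (removal) or $F\cap E=\emptyset$ (addition); its gain $\Delta_I(F)$ is $\mathbb E_H[\mathsf{MoV}(E\setminus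 F,H)-\mathsf{MoV}(E,H)]$, respectively $\mathbb E_H[\mathsf{MoV}(E\cup F,H)-\mathsf{MoV}(E,H)]$, and is to be maximized. A feasible $F$ is a $\rho$-approximation if $\Delta_I(F)\ge\rho\,\Delta_I(F')$ for all feasible $F'$. A reoptimization input is $R=(I,E^*,e,o)$ with $E^*$ an optimal solution of $I$, $e\in E$ and $o\in[0,1]\cap\mathbb Q$; the task is to solve the instance $I_1$ obtained from $I$ by changing $p(e)$ to $o$. Sizes are lengths of encodings with numbers in binary. The spread of $I$ is $\max_v\{\max_i\pi_v(i)-\min_i\pi_v(i)\}$. For a polynomial $q$ let $\mathcal C_q$ be the class of instances whose spread is at most $q(\mathrm{size}(I))$. Scores are unitary if all $\pi_v(i)\in\{0,\dots,\ell\}$. **Theorem.** Fix removal or addition, and a polynomial $q$. Reoptimization is as hard as optimization on $\mathcal C_q$: there are algorithms $f,g$ and a polynomial $r$ bounding their running times such that the following holds. 1. For every $I\in\mathcal C_q$, $f$ computes from $I$ a reoptimization input $R=(I',E^*,e,o)$ such that $E^*$ is an optimal solution of $I'$, $I'\in\mathcal C_q$, $I'$ has the same number of candidates and the same budget as $I$,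 and $I'$ has unitary scores if $I$ has. From $I$ and any feasible solution $F$ of the changed instance $I'_1$, $g$ computes a feasible solution $F'$ of $I$ with $\Delta_I(F')=\Delta_{I'_1}(F)$. Conversely, every value $\Delta_I(F')$ of a feasible solution $F'$ of $I$ is the value of a feasible solution of $I'_1$. (So the optima agree, and $g$ maps optimal solutions to optimal solutions and $\rho$-approximations to $\rho$-approximations.) 2. Consequently, hardness results carry over to reoptimization. Let $\mathcal K\subseteq\mathcal C_q$ be any class of instances, and let $\rho,\rho':\mathbb N\to[0,\infty)$ satisfy $\rho'(n)\le\rho(m)$ whenever $m\le r(n)$ (for instance $\rho=\rho'$ constant). If no polynomial-time algorithm returns a $\rho'(\mathrm{size})$-approximation for all instances in $\mathcal K$, then no polynomial-time algorithm returns a $\rho(\mathrm{size})$-approximation for all reoptimization inputs $(I',E^*,e,o)$ such that $I'\in\mathcal C_q$ and, for some $I\in\mathcal K$, $I'$ has the same number of candidates and the same budget as $I$, and unitary scores if $I$ has. -/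

import Mathlib

/-! ### Computation model: structured programs on binary trees, with a cost measure -/

/-- Binary trees, the data on which programs work. -/
inductive Data : Type
  | nil : Data
  | cons : Data → Data → Data

/-- The number of nodes of a tree. -/
def Data.size : Data → ℕ
  | .nil => 1
  | .cons a b => a.size + b.size + 1

/-- Programs of the (one-variable) WHILE language on binary trees. The tree `nil` is the truth
value "false", every other tree is "true". -/
inductive Prog : Type
  /-- return `nil` -/
  | nil : Prog
  /-- return the input -/
  | id : Prog
  /-- left subtree of the input (`nil` if the input is `nil`) -/
  | hd : Prog
  /-- right subtree of the input (`nil` if the input is `nil`) -/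
  | tl : Prog
  /-- `pair f g` returns `cons (f x) (g x)` -/
  | pair : Prog → Prog → Prog
  /-- `seq f g` runs `f`, then `g` on the result of `f` -/
  | seq : Prog → Prog → Prog
  /-- `ite c f g` runs `f` on the input if `c` returns true on it, and `g` otherwise -/
  | ite : Prog → Prog → Prog → Prog
  /-- `loop c f` replaces the current value `x` by `f x` as long as `c` returns true on `x` -/
  | loop : Prog → Prog → Prog

/-- `Runs c x y t`: the program `c` halts on input `x` with output `y` and total cost `t`.
Every elementary step costs one unit plus the number of nodes of the tree it delivers, so that
the cost is polynomially related to the running time of a Turing machine. -/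
inductive Prog.Runs : Prog → Data → Data → ℕ → Prop
  | nil (x : Data) : Runs .nil x .nil (1 + Data.nil.size)
  | id (x : Data) : Runs .id x x (1 + x.size)
  | hd_nil : Runs .hd .nil .nil (1 + Data.nil.size)
  | hd_cons (a b : Data) : Runs .hd (.cons a b) a (1 + a.size)
  | tl_nil : Runs .tl .nil .nil (1 + Data.nil.size)
  | tl_cons (a b : Data) : Runs .tl (.cons a b) b (1 + b.size)
  | pair {f g : Prog} {x a b : Data} {s t : ℕ} :
      Runs f x a s → Runs g x b t →
      Runs (.pair f g) x (.cons a b) (s + t + (1 + (Data.cons a b).size))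
  | seq {f g : Prog} {x y z : Data} {s t : ℕ} :
      Runs f x y s → Runs g y z t → Runs (.seq f g) x z (s + t + 1)
  | ite_true {c f g : Prog} {x a b y : Data} {s t : ℕ} :
      Runs c x (.cons a b) s → Runs f x y t → Runs (.ite c f g) x y (s + t + 1)
  | ite_false {c f g : Prog} {x y : Data} {s t : ℕ} :
      Runs c x .nil s → Runs g x y t → Runs (.ite c f g) x y (s + t + 1)
  | loop_done {c f : Prog} {x : Data} {s : ℕ} :
      Runs c x .nil s → Runs (.loop c f) x x (s + (1 + x.size))
  | loop_step {c f : Prog} {x a b y z : Data} {s t u : ℕ} :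
      Runs c x (.cons a b) s → Runs f x y t → Runs (.loop c f) y z u →
      Runs (.loop c f) x z (s + t + u + 1)

/-- On input `x`, the program `c` outputs `y`, with cost at most `r (size of x)`. -/
def Prog.RunsWithin (c : Prog) (r : Polynomial ℕ) (x y : Data) : Prop :=
  ∃ t ≤ r.eval x.size, c.Runs x y t

/-! ### Encoding of basic objects (numbers in binary) -/

namespace Data

def ofList (l : List Data) : Data := l.foldr Data.cons Data.nil

def ofBool : Bool → Data
  | false => .nil
  | true => .cons .nil .nil

/-- Binary representation, least significant bit first. -/
def ofNat (n : ℕ) : Data := ofList (n.bits.map ofBool)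

/-- Sign and absolute value. -/
def ofInt (z : ℤ) : Data := .cons (ofBool (decide (z < 0))) (ofNat z.natAbs)

/-- Numerator and denominator in lowest terms. -/
def ofRat (x : ℚ) : Data := .cons (ofInt x.num) (ofNat x.den)

def ofOption : Option Data → Data
  | none => .nil
  | some d => .cons .nil d

/-- The list of the values of a function on `Fin n`. -/
def ofFamily {n : ℕ} (f : Fin n → Data) : Data := ofList (List.ofFn f)

/-- A set of ordered pairs, as its 0-1 matrix. -/
def ofEdges {n : ℕ} (F : Finset (Fin n × Fin n)) : Data :=
  ofFamily fun u => ofFamily fun v => ofBool (decide ((u, v) ∈ F))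

end Data

/-! ### Election control -/

/-- An instance of election control by modification of the edges: voters `Fin n`, candidates
`c_0, …, c_ℓ`, scores, seeds with their messages, edges, influence probabilities and budget. -/
structure Instance where
  /-- number of voters -/
  n : ℕ
  n_pos : 0 < n
  /-- there are `ℓ + 1` candidates, and at least two; the manipulator's candidate is `c_0` -/
  ℓ : ℕ
  ℓ_pos : 0 < ℓ
  /-- `score v i` is the score that voter `v` gives to candidate `c_i` -/
  score : Fin n → Fin (ℓ + 1) → ℕ
  score_injective : ∀ v, Function.Injective (score v)
  /-- `message v` is the message sent by `v` if `v` is a seed, and `none` if `v` is not -/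
  message : Fin n → Option (Fin (ℓ + 1) → ℤ)
  /-- the edges of the network -/
  edges : Finset (Fin n × Fin n)
  /-- the strength of the (potential) influence, on all ordered pairs of voters -/
  prob : Fin n × Fin n → ℚ
  prob_nonneg : ∀ e, 0 ≤ prob e
  prob_le_one : ∀ e, prob e ≤ 1
  /-- the budget, possibly infinite -/
  budget : ℕ∞

/-- The two forms of manipulation. -/
inductive Modification : Type
  | removal
  | addition

/-- Diffusion of the message of `s` along a graph `L`, up to time `t`: the first component is
the set of voters activated exactly at time `t`, the second one is the set of voters activated at
some time `≤ t`. -/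
def diffusion {n : ℕ} (L : Finset (Fin n × Fin n)) (s : Fin n) :
    ℕ → Finset (Fin n) × Finset (Fin n)
  | 0 => ({s}, {s})
  | t + 1 =>
    let old := diffusion L s t
    let new := Finset.univ.filter fun v => v ∉ old.2 ∧ ∃ u ∈ old.1, (u, v) ∈ L
    (new, old.2 ∪ new)

/-- The message of `s`, spreading along `L`, activates `v` at some time. -/
def Influenced {n : ℕ} (L : Finset (Fin n × Fin n)) (s v : Fin n) : Prop :=
  ∃ t, v ∈ (diffusion L s t).1

namespace Instance

/-- The tie-breaking parameter `1 / (1 + max_{v,i} π_v(i))`. -/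
def eps (I : Instance) : ℚ :=
  1 / (1 + ((Finset.univ.sup fun v => Finset.univ.sup fun i => I.score v i : ℕ) : ℚ))

/-- The information on `c_i` in the message of `s` (`0` if `s` is not a seed). -/
def news (I : Instance) (s : Fin I.n) (i : Fin (I.ℓ + 1)) : ℤ :=
  match I.message s with
  | none => 0
  | some m => m i

open Classical in
/-- The score of `c_i` for voter `v` after the diffusion along `L`. The factor `1 - ε` on the
initial score breaks ties in favour of the candidate initially ranked lower. -/
noncomputable def finalScore (I : Instance) (L : Finset (Fin I.n × Fin I.n)) (v : Fin I.n)
    (i : Fin (I.ℓ + 1)) : ℚ :=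
  (1 - I.eps) * (I.score v i : ℚ) +
    ((∑ s ∈ Finset.univ.filter (fun s => (I.message s).isSome ∧ Influenced L s v),
      I.news s i : ℤ) : ℚ)

open Classical in
/-- The voters who rank `c` first after the diffusion along `L`. -/
noncomputable def votersFor (I : Instance) (L : Finset (Fin I.n × Fin I.n))
    (c : Fin (I.ℓ + 1)) : Finset (Fin I.n) :=
  Finset.univ.filter fun v => ∀ j, j ≠ c → I.finalScore L v j < I.finalScore L v c

/-- Margin of victory of `c_0` if the edge set is `A` and the set of live pairs is `H`. -/
noncomputable def mov (I : Instance) (A H : Finset (Fin I.n × Fin I.n)) : ℤ :=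
  ((I.votersFor (A ∩ H) 0).card : ℤ) -
    (((Finset.univ.filter fun c : Fin (I.ℓ + 1) => c ≠ 0).sup
      fun c => (I.votersFor (A ∩ H) c).card : ℕ) : ℤ)

/-- The probability that `H` is the set of live pairs: every ordered pair `e` of voters is live
with probability `prob e`, independently. -/
def liveProb (I : Instance) (H : Finset (Fin I.n × Fin I.n)) : ℚ :=
  ∏ e, if e ∈ H then I.prob e else 1 - I.prob e

/-- The edge set after the manipulation `F`. -/
def modify (I : Instance) (F : Finset (Fin I.n × Fin I.n)) :
    Modification → Finset (Fin I.n × Fin I.n)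
  | .removal => I.edges \ F
  | .addition => I.edges ∪ F

/-- The expected increase of the margin of victory due to `F`. -/
noncomputable def gain (I : Instance) (k : Modification) (F : Finset (Fin I.n × Fin I.n)) : ℚ :=
  ∑ H, I.liveProb H * ((I.mov (I.modify F k) H - I.mov I.edges H : ℤ) : ℚ)

/-- Feasible manipulations. -/
def Feasible (I : Instance) (k : Modification) (F : Finset (Fin I.n × Fin I.n)) : Prop :=
  (match k with
    | .removal => F ⊆ I.edges
    | .addition => Disjoint F I.edges) ∧ (F.card : ℕ∞) ≤ I.budget

/-- Optimal solutions. -/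
def IsOptimal (I : Instance) (k : Modification) (F : Finset (Fin I.n × Fin I.n)) : Prop :=
  I.Feasible k F ∧ ∀ F', I.Feasible k F' → I.gain k F' ≤ I.gain k F

/-- `F` is feasible and its gain is at least `ρ` times that of the best solution. -/
def IsApprox (I : Instance) (k : Modification) (ρ : NNReal) (F : Finset (Fin I.n × Fin I.n)) :
    Prop :=
  I.Feasible k F ∧ ∀ F', I.Feasible k F' → (ρ : ℝ) * (I.gain k F' : ℝ) ≤ (I.gain k F : ℝ)

/-- `max_v (max_i π_v(i) - min_i π_v(i))`. -/
def spread (I : Instance) : ℕ :=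
  Finset.univ.sup fun v =>
    Finset.univ.sup' Finset.univ_nonempty (I.score v) -
      Finset.univ.inf' Finset.univ_nonempty (I.score v)

/-- Unitary score distances: every voter uses the scores `0, …, ℓ`. -/
def Unitary (I : Instance) : Prop := ∀ v i, I.score v i ≤ I.ℓ

def encode (I : Instance) : Data :=
  .cons
    (Data.ofFamily fun v =>
      .cons (Data.ofFamily fun i => Data.ofNat (I.score v i))
        (Data.ofOption ((I.message v).map fun m => Data.ofFamily fun i => Data.ofInt (m i))))
    (.cons
      (Data.ofFamily fun u => Data.ofFamily fun v =>
        .cons (Data.ofBool (decide ((u, v) ∈ I.edges))) (Data.ofRat (I.prob (u, v))))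
      (match I.budget with
        | none => Data.ofOption none
        | some b => Data.ofOption (some (Data.ofNat b))))

/-- The size of an instance. -/
def size (I : Instance) : ℕ := I.encode.size

/-- The score spread is at most `q (size of the instance)`. -/
def SpreadBounded (q : Polynomial ℕ) (I : Instance) : Prop := I.spread ≤ q.eval I.size

/-- Same number of candidates and same budget; unitary score distances are kept. -/
def SameSetting (I I' : Instance) : Prop :=
  I'.ℓ = I.ℓ ∧ I'.budget = I.budget ∧ (I.Unitary → I'.Unitary)

end Instance

/-- An input of the reoptimization problem: an instance, a solution of it, a pair of voters and
a new probability for this pair. -/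
structure ReoptInstance where
  inst : Instance
  sol : Finset (Fin inst.n × Fin inst.n)
  edge : Fin inst.n × Fin inst.n
  newProb : ℚ
  newProb_nonneg : 0 ≤ newProb
  newProb_le_one : newProb ≤ 1

namespace ReoptInstance

/-- The instance that has to be solved: the probability of the edge is changed. -/
def modified (R : ReoptInstance) : Instance :=
  { R.inst with
    prob := Function.update R.inst.prob R.edge R.newProb
    prob_nonneg := by
      intro e
      by_cases h : e = R.edge
      · subst h; simpa using R.newProb_nonneg
      · simpa [Function.update_of_ne h] using R.inst.prob_nonneg e
    prob_le_one := by
      intro e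
      by_cases h : e = R.edge
      · subst h; simpa using R.newProb_le_one
      · simpa [Function.update_of_ne h] using R.inst.prob_le_one e }

/-- Admissible inputs: the given solution is optimal for the given instance, and the pair whose
probability changes is an edge of the network. -/
def Valid (k : Modification) (R : ReoptInstance) : Prop :=
  R.inst.IsOptimal k R.sol ∧ R.edge ∈ R.inst.edges

def encode (R : ReoptInstance) : Data :=
  .cons R.inst.encode (.cons (Data.ofEdges R.sol)
    (.cons (.cons (Data.ofNat R.edge.1) (Data.ofNat R.edge.2)) (Data.ofRat R.newProb)))

/-- The size of a reoptimization input. -/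
def size (R : ReoptInstance) : ℕ := R.encode.size

end ReoptInstance

/-- There is a polynomial-time algorithm that returns a `ρ`-approximation (`ρ` may depend on the
size) for every instance in the class `K` of the optimization problem. -/
def OptApproximable (k : Modification) (K : Set Instance) (ρ : ℕ → NNReal) : Prop :=
  ∃ (c : Prog) (r : Polynomial ℕ), ∀ I ∈ K,
    ∃ F, I.IsApprox k (ρ I.size) F ∧ c.RunsWithin r I.encode (Data.ofEdges F)

/-- There is a polynomial-time algorithm that, given an instance in the class `K` together with
an optimal solution and a change of the probability of one edge, returns a `ρ`-approximation for
the changed instance. -/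
def ReoptApproximable (k : Modification) (K : Set Instance) (ρ : ℕ → NNReal) : Prop :=
  ∃ (c : Prog) (r : Polynomial ℕ), ∀ R : ReoptInstance, R.Valid k → R.inst ∈ K →
    ∃ F, R.modified.IsApprox k (ρ R.size) F ∧ c.RunsWithin r R.encode (Data.ofEdges F)

/-!
Add to an instance `I` a seed `0` and a voter `1`, with edges from `0` to `1` and from `1` to all
old voters, the latter of probability `1`. The message of `0` gives `c_0` a weight, `2 ^ size I`,
that exceeds everything else in `I`. If the edge `(0, 1)` has probability `1` and nothing is
modified, everybody votes for `c_0`, so the empty set is optimal. If the probability of `(0, 1)`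
drops to `0`, the new voters influence no old voter and always vote for `c_0`: all margins of
victory are those of `I` shifted by the constant `2`, and the gain of a solution is the gain in `I`
of its restriction to the old voters. An approximation algorithm for the changed instance is
therefore one for `I`.
-/

/-! ### Polynomial time -/

theorem monotone_polynomial_eval {R : Type*} [Semiring R] [PartialOrder R] [IsOrderedRing R]
    [CanonicallyOrderedAdd R] (r : Polynomial R) : Monotone fun x => r.eval x := by
  intro x y hxy
  simp only [Polynomial.eval_eq_sum_range]
  gcongr

namespace Data

/-- The left subtree, with the convention of `Prog.hd` that the one of `nil` is `nil`. -/
def left : Data → Data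
  | nil => nil
  | cons a _ => a

/-- The right subtree, with the convention of `Prog.tl` that the one of `nil` is `nil`. -/
def right : Data → Data
  | nil => nil
  | cons _ b => b

/-- Case distinction on the truth value of a tree, as in `Prog.ite`. -/
def cond (c x y : Data) : Data :=
  match c with
  | nil => y
  | cons _ _ => x

@[simp] theorem left_nil : left nil = nil := rfl
@[simp] theorem left_cons (a b : Data) : left (cons a b) = a := rfl
@[simp] theorem right_nil : right nil = nil := rfl
@[simp] theorem right_cons (a b : Data) : right (cons a b) = b := rfl
@[simp] theorem cond_nil (x y : Data) : cond nil x y = y := rfl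
@[simp] theorem cond_cons (a b x y : Data) : cond (cons a b) x y = x := rfl
@[simp] theorem size_nil : size nil = 1 := rfl
@[simp] theorem size_cons (a b : Data) : size (cons a b) = a.size + b.size + 1 := rfl

theorem size_pos (x : Data) : 0 < x.size := by cases x <;> simp

theorem size_left_le (x : Data) : x.left.size ≤ x.size := by
  cases x <;> simp; omega

theorem size_right_le (x : Data) : x.right.size ≤ x.size := by
  cases x <;> simp; omega

end Data

namespace Prog

theorem Runs.size_le {c : Prog} {x y : Data} {t : ℕ} (h : c.Runs x y t) : y.size ≤ t := by
  induction h <;> omega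

theorem Runs.hd (x : Data) : Prog.hd.Runs x x.left (1 + x.left.size) := by
  cases x with
  | nil => exact .hd_nil
  | cons a b => exact .hd_cons a b

theorem Runs.tl (x : Data) : Prog.tl.Runs x x.right (1 + x.right.size) := by
  cases x with
  | nil => exact .tl_nil
  | cons a b => exact .tl_cons a b

namespace RunsWithin
variable {c d : Prog} {r r' : Polynomial ℕ} {x y z : Data}

theorem size_le (h : c.RunsWithin r x y) : y.size ≤ r.eval x.size := by
  obtain ⟨t, ht, hr⟩ := h
  exact hr.size_le.trans ht

theorem mono (h : c.RunsWithin r x y) (hr : ∀ n, r.eval n ≤ r'.eval n) :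
    c.RunsWithin r' x y := by
  obtain ⟨t, ht, h⟩ := h
  exact ⟨t, ht.trans (hr _), h⟩

theorem id (x : Data) : Prog.id.RunsWithin (1 + .X) x x :=
  ⟨_, by simp, .id x⟩

theorem seq (h : c.RunsWithin r x y) (h' : d.RunsWithin r' y z) :
    (Prog.seq c d).RunsWithin (r + r'.comp r + 1) x z := by
  have hr' := monotone_polynomial_eval r' h.size_le
  obtain ⟨s, hs, h⟩ := h
  obtain ⟨t, ht, h'⟩ := h'
  refine ⟨_, ?_, h.seq h'⟩
  simp only [Polynomial.eval_add, Polynomial.eval_comp, Polynomial.eval_one] at hr' ⊢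
  omega

theorem pair (h : c.RunsWithin r x y) (h' : d.RunsWithin r' x z) :
    (Prog.pair c d).RunsWithin (2 * r + 2 * r' + 2) x (.cons y z) := by
  have hy := h.size_le
  have hz := h'.size_le
  obtain ⟨s, hs, h⟩ := h
  obtain ⟨t, ht, h'⟩ := h'
  refine ⟨_, ?_, h.pair h'⟩
  simp only [Polynomial.eval_add, Polynomial.eval_mul, Polynomial.eval_ofNat, Data.size_cons]
  omega

end RunsWithin

theorem exists_runs_loop_hd {p : Prog} {r : Polynomial ℕ} {step : Data → Data}
    (hp : ∀ z, p.RunsWithin r z (step z)) {inv : Data → Prop} {μ : Data → ℕ} {B : ℕ}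
    (hstep : ∀ z, inv z → z.left ≠ .nil → inv (step z) ∧ μ (step z) < μ z)
    (hsize : ∀ z, inv z → z.size ≤ B) (m : ℕ) :
    ∀ z, inv z → μ z ≤ m → ∃ z', inv z' ∧ z'.left = .nil ∧
      ∃ t ≤ (m + 1) * (r.eval B + 2 * B + 5), (Prog.loop .hd p).Runs z z' t := by
  induction m with
  | zero =>
    intro z hz hμ
    have hleft : z.left = .nil := by
      by_contra hne
      have := (hstep z hz hne).2
      omega
    have htest := Runs.hd z
    have hzB := hsize z hz
    have hle := z.size_left_le
    rw [hleft] at htest hle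
    exact ⟨z, hz, hleft, _, by omega, .loop_done htest⟩
  | succ m ih =>
    intro z hz hμ
    have htest := Runs.hd z
    have hzB := hsize z hz
    have hle := z.size_left_le
    cases hleft : z.left with
    | nil =>
      rw [hleft] at htest hle
      exact ⟨z, hz, hleft, _, by rw [Nat.succ_mul]; omega, .loop_done htest⟩
    | cons a b =>
      rw [hleft] at htest hle
      obtain ⟨hinv, hlt⟩ := hstep z hz (by simp [hleft])
      obtain ⟨z', hz', hnil, u, hu, hrest⟩ := ih _ hinv (by omega)
      obtain ⟨t, ht, hbody⟩ := hp z
      have hr : r.eval z.size ≤ r.eval B := monotone_polynomial_eval r hzB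
      refine ⟨z', hz', hnil, _, ?_, .loop_step htest hbody hrest⟩
      rw [Nat.succ_mul (m + 1)]
      omega

end Prog

/-- `f` is computed by a program within a polynomial cost. -/
def PolyTime (f : Data → Data) : Prop :=
  ∃ (c : Prog) (r : Polynomial ℕ), ∀ x, c.RunsWithin r x (f x)

namespace PolyTime
variable {c f g : Data → Data}

theorem exists_size_le (hf : PolyTime f) :
    ∃ r : Polynomial ℕ, ∀ x, (f x).size ≤ r.eval x.size := by
  obtain ⟨p, r, hp⟩ := hf
  exact ⟨r, fun x => (hp x).size_le⟩

theorem id : PolyTime fun x => x := ⟨_, _, Prog.RunsWithin.id⟩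

theorem comp (hg : PolyTime g) (hf : PolyTime f) : PolyTime fun x => g (f x) := by
  obtain ⟨p, r, hp⟩ := hf
  obtain ⟨p', r', hp'⟩ := hg
  exact ⟨_, _, fun x => (hp x).seq (hp' _)⟩

theorem pair (hf : PolyTime f) (hg : PolyTime g) : PolyTime fun x => .cons (f x) (g x) := by
  obtain ⟨p, r, hp⟩ := hf
  obtain ⟨p', r', hp'⟩ := hg
  exact ⟨_, _, fun x => (hp x).pair (hp' x)⟩

theorem const (d : Data) : PolyTime fun _ => d := by
  induction d with
  | nil => exact ⟨.nil, 2, fun x => ⟨_, by simp, .nil x⟩⟩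
  | cons a b iha ihb => exact iha.pair ihb

theorem left (hf : PolyTime f) : PolyTime fun x => (f x).left :=
  comp (g := Data.left)
    ⟨.hd, 1 + .X, fun x => ⟨_, by simpa using x.size_left_le, .hd x⟩⟩ hf

theorem right (hf : PolyTime f) : PolyTime fun x => (f x).right :=
  comp (g := Data.right)
    ⟨.tl, 1 + .X, fun x => ⟨_, by simpa using x.size_right_le, .tl x⟩⟩ hf

theorem cond (hc : PolyTime c) (hf : PolyTime f) (hg : PolyTime g) :
    PolyTime fun x => (c x).cond (f x) (g x) := by
  obtain ⟨pc, rc, hc⟩ := hc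
  obtain ⟨pf, rf, hf⟩ := hf
  obtain ⟨pg, rg, hg⟩ := hg
  refine ⟨.ite pc pf pg, rc + rf + rg + 1, fun x => ?_⟩
  obtain ⟨s, hs, hc⟩ := hc x
  obtain ⟨t, ht, hf⟩ := hf x
  obtain ⟨u, hu, hg⟩ := hg x
  simp only [Prog.RunsWithin, Polynomial.eval_add, Polynomial.eval_one]
  cases h : c x with
  | nil =>
    rw [h] at hc
    exact ⟨_, by omega, .ite_false hc hg⟩
  | cons a b =>
    rw [h] at hc
    exact ⟨_, by omega, .ite_true hc hf⟩

/-- The state of the loop is `cons s a`, where the control component `s` ends the loop when it is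
`nil` and `a` is an accumulator. The invariant also mentions the input `x`. -/
theorem loop {s₀ a₀ next update out : Data → Data} (hs₀ : PolyTime s₀) (ha₀ : PolyTime a₀)
    (hnext : PolyTime next) (hupdate : PolyTime update)
    (inv : Data → Data → Data → Prop) (μ : Data → ℕ) (B : Polynomial ℕ)
    (start : ∀ x, inv x (s₀ x) (a₀ x))
    (step : ∀ x b c a, inv x (.cons b c) a →
      inv x (next (.cons (.cons b c) a)) (update (.cons (.cons b c) a)) ∧
        μ (next (.cons (.cons b c) a)) < μ (.cons b c))
    (finish : ∀ x a, inv x .nil a → a = out x)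
    (variant_le : ∀ s, μ s ≤ s.size)
    (size_le : ∀ x s a, inv x s a → s.size + a.size + 1 ≤ B.eval x.size) : PolyTime out := by
  obtain ⟨body, r, hbody⟩ := hnext.pair hupdate
  obtain ⟨init, r', hinit⟩ := hs₀.pair ha₀
  suffices PolyTime fun x => .cons .nil (out x) from this.right
  refine ⟨.seq init (.loop .hd body), r' + (B + 1) * (r.comp B + 2 * B + 5) + 1, fun x => ?_⟩
  obtain ⟨_, ⟨s, a, rfl, hinv⟩, rfl, t, ht, hloop⟩ := Prog.exists_runs_loop_hd hbody
    (inv := fun z => ∃ s a, z = .cons s a ∧ inv x s a) (μ := fun z => μ z.left)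
    (B := B.eval x.size)
    (by
      rintro _ ⟨s, a, rfl, hinv⟩ hne
      cases s with
      | nil => exact absurd rfl hne
      | cons b c => exact ⟨⟨_, _, rfl, (step x b c a hinv).1⟩, (step x b c a hinv).2⟩)
    (by
      rintro _ ⟨s, a, rfl, hinv⟩
      exact size_le x s a hinv)
    (B.eval x.size) _ ⟨_, _, rfl, start x⟩
    (by
      have := variant_le (s₀ x)
      have := size_le x _ _ (start x)
      simp only [Data.left_cons]
      omega)
  obtain ⟨u, hu, hinit⟩ := hinit x
  rw [finish x a hinv] at hloop
  refine ⟨_, ?_, hinit.seq hloop⟩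
  simp only [Polynomial.eval_add, Polynomial.eval_mul, Polynomial.eval_comp, Polynomial.eval_one,
    Polynomial.eval_ofNat]
  omega

end PolyTime

/-! ### Recursion along the right spine -/

namespace Data

/-- Number of nodes on the right spine; this is the length of a tree that is read as a list. -/
def spineLength : Data → ℕ
  | nil => 0
  | cons _ b => b.spineLength + 1

theorem spineLength_le_size (x : Data) : x.spineLength ≤ x.size := by
  induction x with
  | nil => simp [spineLength]
  | cons a b _ ih => simp [spineLength]; omega

/-- Primitive recursion along the right spine; the step gets the current subtree and the value
on its right subtree. -/
def spineRec (e : Data) (s : Data → Data) : Data → Data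
  | nil => e
  | cons a b => s (cons (cons a b) (spineRec e s b))

/-- Push the non-empty spine suffixes of a tree on a stack. -/
def pushSuffixes : Data → Data → Data
  | nil, st => st
  | cons a b, st => pushSuffixes b (cons (cons a b) st)

/-- `Ascends x z st`: the stack `st` holds the spine suffixes of `x` that properly contain the
suffix `z`, the shortest one on top. -/
inductive Ascends (x : Data) : Data → Data → Prop
  | root : Ascends x x nil
  | push {a z st : Data} : Ascends x (cons a z) st → Ascends x z (cons (cons a z) st)

namespace Ascends
variable {x z st : Data}

theorem spineLength_add_size_le (h : Ascends x z st) : st.spineLength + z.size ≤ x.size := by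
  induction h with
  | root => simp [spineLength]
  | @push a z st _ ih =>
    simp only [size_cons, spineLength] at ih ⊢
    have := a.size_pos
    omega

theorem size_le_spineLength_mul (h : Ascends x z st) :
    st.size ≤ st.spineLength * (x.size + 1) + 1 := by
  induction h with
  | root => simp
  | push h ih =>
    have := h.spineLength_add_size_le
    rw [size_cons, spineLength, Nat.succ_mul]
    omega

theorem stack_size_le (h : Ascends x z st) : st.size ≤ x.size * (x.size + 1) + 1 := by
  refine h.size_le_spineLength_mul.trans ?_
  have := h.spineLength_add_size_le
  gcongr
  omega

theorem pushSuffixes (h : Ascends x z st) : Ascends x nil (z.pushSuffixes st) := by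
  induction z generalizing st with
  | nil => exact h
  | cons a z _ ih => exact ih h.push

end Ascends
end Data

namespace PolyTime

theorem pushSuffixes : PolyTime fun x => x.pushSuffixes .nil := by
  refine loop id (const .nil) (next := fun z => z.left.right)
    (update := fun z => .cons z.left z.right) id.left.right (id.left.pair id.right)
    (inv := fun x y st => y.pushSuffixes st = x.pushSuffixes .nil ∧ Data.Ascends x y st)
    (μ := Data.spineLength) (B := .X + .X * (.X + 1) + 2) ?_ ?_ ?_ Data.spineLength_le_size ?_
  · exact fun x => ⟨rfl, .root⟩
  · rintro x a y st ⟨hpush, hst⟩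
    exact ⟨⟨hpush, hst.push⟩, Nat.lt_succ_self _⟩
  · exact fun x st h => h.1
  · rintro x y st ⟨-, hst⟩
    have := hst.spineLength_add_size_le
    have := hst.stack_size_le
    simp only [Polynomial.eval_add, Polynomial.eval_mul, Polynomial.eval_X, Polynomial.eval_one,
      Polynomial.eval_ofNat]
    omega

theorem spineRec {e : Data} {s : Data → Data} (hs : PolyTime s) (p : Polynomial ℕ)
    (hp : ∀ x, (Data.spineRec e s x).size ≤ p.eval x.size) : PolyTime (Data.spineRec e s) := by
  refine loop pushSuffixes (const e) (next := fun z => z.left.right)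
    (update := fun z => s (.cons z.left.left z.right)) id.left.right
    (hs.comp (id.left.left.pair id.right))
    (inv := fun x st v => ∃ y, Data.Ascends x y st ∧ v = Data.spineRec e s y)
    (μ := Data.spineLength) (B := p + .X * (.X + 1) + 2) ?_ ?_ ?_ Data.spineLength_le_size ?_
  · exact fun x => ⟨.nil, Data.Ascends.root.pushSuffixes, rfl⟩
  · rintro x _ st _ ⟨y, hst, rfl⟩
    cases hst with
    | push hst => exact ⟨⟨_, hst, rfl⟩, Nat.lt_succ_self _⟩
  · rintro x _ ⟨y, hst, rfl⟩
    cases hst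
    rfl
  · rintro x st _ ⟨y, hst, rfl⟩
    have hyx := hst.spineLength_add_size_le
    have hst' := hst.stack_size_le
    have hv : (Data.spineRec e s y).size ≤ p.eval x.size :=
      (hp y).trans (monotone_polynomial_eval p (by omega))
    simp only [Polynomial.eval_add, Polynomial.eval_mul, Polynomial.eval_X, Polynomial.eval_one,
      Polynomial.eval_ofNat]
    omega

end PolyTime

namespace Data

/-- Apply `f` to all entries of a list. -/
def map (f : Data → Data) : Data → Data :=
  spineRec nil fun z => cons (f z.left.left) z.right

/-- Successor on the binary representations of natural numbers. -/
def succ : Data → Data :=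
  spineRec (cons (ofBool true) nil) fun z =>
    cond z.left.left (cons nil z.right) (cons (ofBool true) z.left.right)

/-- For a list of length `n`, the list of the binary representations of `n - 1, …, 0`. -/
def countdown : Data → Data :=
  spineRec nil fun z => cond z.right (cons z.right.left.succ z.right) (cons nil nil)

/-- The binary representation of `2 ^ k`, least significant bit first. -/
def powTwo : ℕ → Data
  | 0 => cons (ofBool true) nil
  | k + 1 => cons nil (powTwo k)

@[simp] theorem map_nil (f : Data → Data) : map f nil = nil := rfl
@[simp] theorem map_cons (f : Data → Data) (a b : Data) :
    map f (cons a b) = cons (f a) (map f b) := rfl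
@[simp] theorem succ_nil : succ nil = cons (ofBool true) nil := rfl
@[simp] theorem succ_cons (a b : Data) :
    succ (cons a b) = cond a (cons nil b.succ) (cons (ofBool true) b) := rfl
@[simp] theorem countdown_nil : countdown nil = nil := rfl
@[simp] theorem countdown_cons (a b : Data) : countdown (cons a b) =
    cond b.countdown (cons b.countdown.left.succ b.countdown) (cons nil nil) := rfl

theorem size_map_le {f : Data → Data} {N : ℕ} {r : Polynomial ℕ}
    (hf : ∀ x, (f x).size ≤ r.eval x.size) (x : Data) (hx : x.size ≤ N) :
    (x.map f).size ≤ (r.eval N + 1) * x.size + 1 := by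
  induction x with
  | nil => simp
  | cons a b _ ih =>
    rw [size_cons] at hx
    have hb := ih (by omega)
    have ha : (f a).size ≤ r.eval N :=
      (hf a).trans (monotone_polynomial_eval r (by omega))
    simp only [map_cons, size_cons]
    nlinarith

theorem size_le_size_map {f : Data → Data} (hf : ∀ x, x.size ≤ (f x).size) (x : Data) :
    x.size ≤ (x.map f).size := by
  induction x with
  | nil => simp
  | cons a b _ ih =>
    have := hf a
    simp only [map_cons, size_cons]
    omega

theorem size_succ_le (x : Data) : x.succ.size ≤ x.size + 4 := by
  induction x with
  | nil => simp [ofBool]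
  | cons a b _ ih =>
    cases a <;> simp [ofBool] <;> omega

theorem size_left_countdown_le (x : Data) : x.countdown.left.size ≤ 4 * x.size := by
  induction x with
  | nil => simp
  | cons a b _ ih =>
    have hs := size_succ_le b.countdown.left
    have ha := a.size_pos
    rw [countdown_cons]
    cases hb : b.countdown with
    | nil => simp only [cond_nil, left_cons, size_cons, size_nil]; omega
    | cons c d =>
      rw [hb] at ih hs
      simp only [cond_cons, left_cons, size_cons] at ih hs ⊢
      omega

theorem size_countdown_le (x : Data) : x.countdown.size ≤ (4 * x.size + 1) * x.size := by
  induction x with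
  | nil => simp
  | cons a b _ ih =>
    have ha := a.size_pos
    have hb := b.size_pos
    have hhead := size_left_countdown_le (cons a b)
    rw [countdown_cons] at hhead ⊢
    cases hb : b.countdown with
    | nil =>
      simp only [cond_nil, size_cons, size_nil]
      nlinarith
    | cons c d =>
      rw [hb] at ih hhead
      simp only [cond_cons, left_cons, size_cons] at ih hhead ⊢
      nlinarith

theorem size_powTwo (k : ℕ) : (powTwo k).size = 2 * k + 5 := by
  induction k with
  | zero => simp [powTwo, ofBool]
  | succ k ih => simp [powTwo, ih]; omega

/-- The sum of the sizes of the entries of a list. -/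
def entrySizes : Data → ℕ
  | nil => 0
  | cons a b => a.size + entrySizes b

theorem entrySizes_le_size (x : Data) : x.entrySizes ≤ x.size := by
  induction x with
  | nil => simp [entrySizes]
  | cons a b _ ih => simp [entrySizes]; omega

/-- Replace the tree on top of a stack by its two subtrees; if it is `nil`, just remove it. -/
def popNode (st : Data) : Data :=
  cond st.left (cons st.left.left (cons st.left.right st.right)) st.right

theorem entrySizes_popNode_add_one (a b : Data) :
    (popNode (cons a b)).entrySizes + 1 = (cons a b).entrySizes := by
  cases a <;> simp [popNode, entrySizes] <;> omega

theorem size_popNode_le (st : Data) : (popNode st).size ≤ st.size := by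
  cases st with
  | nil => simp [popNode]
  | cons a b => cases a <;> simp [popNode] <;> omega

end Data

namespace PolyTime

theorem map {f : Data → Data} (hf : PolyTime f) : PolyTime (Data.map f) := by
  obtain ⟨r, hr⟩ := hf.exists_size_le
  refine spineRec ((hf.comp id.left.left).pair id.right) ((r + 1) * .X + 1) fun x => ?_
  exact (Data.size_map_le hr x le_rfl).trans_eq (by simp)

theorem succ : PolyTime Data.succ :=
  spineRec (cond id.left.left ((const _).pair id.right) ((const _).pair id.left.right)) (.X + 4)
    fun x => x.size_succ_le.trans_eq (by simp)

theorem countdown : PolyTime Data.countdown :=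
  spineRec (cond id.right ((succ.comp id.right.left).pair id.right) (const _))
    ((4 * .X + 1) * .X) fun x => x.size_countdown_le.trans_eq (by simp)

theorem popNode : PolyTime Data.popNode :=
  cond id.left (id.left.left.pair (id.left.right.pair id.right)) id.right

theorem powTwo_size : PolyTime fun x => Data.powTwo x.size := by
  refine loop (id.pair (const .nil)) (const (Data.powTwo 0)) (next := fun z => z.left.popNode)
    (update := fun z => .cons .nil z.right) (popNode.comp id.left) ((const _).pair id.right)
    (inv := fun x st a => st.size ≤ x.size + 2 ∧ ∃ k, a = Data.powTwo k ∧
      k + st.entrySizes = x.size)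
    (μ := Data.entrySizes) (B := 3 * .X + 8) ?_ ?_ ?_ Data.entrySizes_le_size ?_
  · exact fun x => ⟨by simp, 0, rfl, by simp [Data.entrySizes]⟩
  · rintro x b c _ ⟨hsize, k, rfl, hk⟩
    have hpop := Data.entrySizes_popNode_add_one b c
    refine ⟨⟨(Data.size_popNode_le _).trans hsize, k + 1, rfl, ?_⟩, ?_⟩ <;>
    · rw [Data.left_cons]
      omega
  · rintro x _ ⟨-, k, rfl, hk⟩
    rw [← hk]
    rfl
  · rintro x st _ ⟨hsize, k, rfl, hk⟩
    simp only [Data.size_powTwo, Polynomial.eval_add, Polynomial.eval_mul, Polynomial.eval_X,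
      Polynomial.eval_ofNat]
    omega

end PolyTime

/-! ### Encodings of numbers and families -/

namespace Data

theorem ofFamily_zero (f : Fin 0 → Data) : ofFamily f = nil := by
  simp [ofFamily, ofList]

theorem ofFamily_succ {n : ℕ} (f : Fin (n + 1) → Data) :
    ofFamily f = cons (f 0) (ofFamily fun i => f i.succ) := by
  simp [ofFamily, ofList, List.ofFn_succ]

theorem left_ofFamily {n : ℕ} (hn : 0 < n) (f : Fin n → Data) : (ofFamily f).left = f ⟨0, hn⟩ := by
  cases n with
  | zero => exact absurd hn (lt_irrefl 0)
  | succ n => rw [ofFamily_succ]; rfl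

theorem map_ofFamily {n : ℕ} (g : Data → Data) (f : Fin n → Data) :
    (ofFamily f).map g = ofFamily fun i => g (f i) := by
  induction n with
  | zero => simp [ofFamily_zero]
  | succ n ih => rw [ofFamily_succ, ofFamily_succ, map_cons, ih]

theorem ofNat_zero : ofNat 0 = nil := by simp [ofNat, ofList]

theorem ofNat_two_mul {n : ℕ} (hn : n ≠ 0) : ofNat (2 * n) = cons nil (ofNat n) := by
  simp [ofNat, Nat.bit0_bits n hn, ofList, ofBool]

theorem ofNat_two_mul_add_one (n : ℕ) :
    ofNat (2 * n + 1) = cons (ofBool true) (ofNat n) := by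
  simp [ofNat, ofList]

theorem ofNat_two_pow (k : ℕ) : ofNat (2 ^ k) = powTwo k := by
  induction k with
  | zero => exact ofNat_two_mul_add_one 0
  | succ k ih => rw [pow_succ', ofNat_two_mul (by positivity), ih, powTwo]

theorem succ_ofNat (n : ℕ) : (ofNat n).succ = ofNat (n + 1) := by
  induction n using Nat.strong_induction_on with
  | _ n ih =>
    rcases Nat.even_or_odd' n with ⟨m, rfl | rfl⟩
    · rcases eq_or_ne m 0 with rfl | hm
      · simp [ofNat, ofList]
      · rw [ofNat_two_mul hm, ofNat_two_mul_add_one, succ_cons, cond_nil]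
    · rw [ofNat_two_mul_add_one, show 2 * m + 1 + 1 = 2 * (m + 1) by ring,
        ofNat_two_mul (Nat.succ_ne_zero m), ← ih m (by omega)]
      rfl

theorem countdown_ofFamily {n : ℕ} (f : Fin (n + 1) → Data) :
    (ofFamily f).countdown = ofFamily fun i : Fin (n + 1) => ofNat (n - i) := by
  induction n with
  | zero => simp [ofFamily_succ, ofFamily_zero, ofNat_zero]
  | succ n ih =>
    have htail : (ofFamily fun i : Fin (n + 1) => ofNat (n + 1 - i.succ)) =
        ofFamily fun i : Fin (n + 1) => ofNat (n - i) := by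
      simp
    rw [ofFamily_succ, countdown_cons, ih, ofFamily_succ (n := n + 1), htail,
      ofFamily_succ (n := n)]
    simp [succ_ofNat]

theorem lt_two_pow_size_ofNat (n : ℕ) : n < 2 ^ (ofNat n).size := by
  have length_le : ∀ l : List Data, l.length ≤ (ofList l).size := by
    intro l
    induction l with
    | nil => simp
    | cons a l ih =>
      have : (ofList (a :: l)).size = a.size + (ofList l).size + 1 := rfl
      simp only [List.length_cons]
      omega
  have hbits := length_le (n.bits.map ofBool)
  rw [List.length_map, Nat.size_eq_bits_len] at hbits
  exact (Nat.lt_size_self n).trans_le (Nat.pow_le_pow_right two_pos hbits)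

theorem natAbs_lt_two_pow_size_ofInt (z : ℤ) : z.natAbs < 2 ^ (ofInt z).size :=
  (lt_two_pow_size_ofNat _).trans_le
    (Nat.pow_le_pow_right two_pos (by simp only [ofInt, size_cons]; omega))

theorem add_lt_two_pow_size_cons {m n : ℕ} {a b : Data} (hm : m < 2 ^ a.size)
    (hn : n < 2 ^ b.size) : m + n < 2 ^ (cons a b).size := by
  rw [size_cons, pow_succ, pow_add]
  nlinarith [@Nat.one_le_two_pow a.size, @Nat.one_le_two_pow b.size]

theorem sum_lt_two_pow_size_ofFamily {n : ℕ} {a : Fin n → ℕ} {f : Fin n → Data}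
    (h : ∀ i, a i < 2 ^ (f i).size) : ∑ i, a i < 2 ^ (ofFamily f).size := by
  induction n with
  | zero => simp
  | succ n ih =>
    rw [Fin.sum_univ_succ, ofFamily_succ]
    exact add_lt_two_pow_size_cons (h 0) (ih fun i => h i.succ)

end Data

/-! ### Two additional voters -/

theorem influenced_of_mem_diffusion_snd {n : ℕ} {L : Finset (Fin n × Fin n)} {s v : Fin n} {t : ℕ}
    (hv : v ∈ (diffusion L s t).2) : Influenced L s v := by
  induction t with
  | zero => exact ⟨0, hv⟩
  | succ t ih => exact (Finset.mem_union.1 hv).elim ih fun h => ⟨t + 1, h⟩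

theorem influenced_iff_reflTransGen {n : ℕ} {L : Finset (Fin n × Fin n)} {s v : Fin n} :
    Influenced L s v ↔ Relation.ReflTransGen (fun u w => (u, w) ∈ L) s v := by
  constructor
  · rintro ⟨t, ht⟩
    induction t generalizing v with
    | zero =>
      obtain rfl : v = s := by simpa [diffusion] using ht
      exact .refl
    | succ t ih =>
      obtain ⟨-, u, hu, huv⟩ := (Finset.mem_filter.1 ht).2
      exact (ih hu).tail huv
  · intro h
    induction h with
    | refl => exact ⟨0, by simp [diffusion]⟩
    | @tail u w _ huw ih =>
      obtain ⟨t, ht⟩ := ih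
      by_cases hw : w ∈ (diffusion L s t).2
      · exact influenced_of_mem_diffusion_snd hw
      · exact ⟨t + 1, Finset.mem_filter.2 ⟨Finset.mem_univ _, hw, u, ht, huw⟩⟩

/-- The position of an old voter after two new voters have been put in front. -/
def shift {n : ℕ} (v : Fin n) : Fin (n + 2) := v.succ.succ

theorem shift_injective {n : ℕ} : Function.Injective (shift (n := n)) :=
  (Fin.succ_injective _).comp (Fin.succ_injective _)

/-- The position of a pair of old voters among the pairs of all voters. -/
def shiftPair {n : ℕ} : Fin n × Fin n ↪ Fin (n + 2) × Fin (n + 2) :=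
  ⟨Prod.map shift shift, shift_injective.prodMap shift_injective⟩

section
variable {n : ℕ}

@[simp] theorem shift_inj {u v : Fin n} : shift u = shift v ↔ u = v := shift_injective.eq_iff

@[simp] theorem shiftPair_mk (u v : Fin n) : shiftPair (u, v) = (shift u, shift v) := rfl

@[simp] theorem shift_ne_zero (v : Fin n) : shift v ≠ 0 := Fin.succ_ne_zero _

@[simp] theorem shift_ne_one (v : Fin n) : shift v ≠ 1 :=
  fun h => Fin.succ_ne_zero v (Fin.succ_injective _ h)

@[simp] theorem zero_ne_shift (v : Fin n) : 0 ≠ shift v := (shift_ne_zero v).symm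

@[simp] theorem one_ne_shift (v : Fin n) : 1 ≠ shift v := (shift_ne_one v).symm

@[elab_as_elim]
theorem voter_cases {motive : Fin (n + 2) → Prop} (zero : motive 0) (one : motive 1)
    (old : ∀ v, motive (shift v)) (v : Fin (n + 2)) : motive v :=
  Fin.cases zero (Fin.cases one old) v

theorem sum_fin_add_two {M : Type*} [AddCommMonoid M] (f : Fin (n + 2) → M) :
    ∑ v, f v = f 0 + (f 1 + ∑ v, f (shift v)) := by
  rw [Fin.sum_univ_succ, Fin.sum_univ_succ]
  rfl

theorem Data.ofFamily_add_two (f : Fin (n + 2) → Data) :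
    ofFamily f = cons (f 0) (cons (f 1) (ofFamily fun v => f (shift v))) := by
  rw [ofFamily_succ, ofFamily_succ]
  rfl

end

/-- A family on the extended set of voters. -/
def extendFamily {α : Type*} {n : ℕ} (x y : α) (f : Fin n → α) : Fin (n + 2) → α :=
  Fin.cons x (Fin.cons y f)

/-- A matrix on the extended set of voters, with entry `x` at `(0, 1)`, entry `y` at `(1, v)` for
all old voters `v`, the entries of `f` on the old pairs, and entry `z` elsewhere. -/
def extendMatrix {α : Type*} {n : ℕ} (x y z : α) (f : Fin n × Fin n → α)
    (e : Fin (n + 2) × Fin (n + 2)) : α :=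
  extendFamily (extendFamily z x fun _ => z) (extendFamily z z fun _ => y)
    (fun u => extendFamily z z fun v => f (u, v)) e.1 e.2

section
variable {α : Type*} {n : ℕ} (x y z : α)

@[simp] theorem extendFamily_zero (f : Fin n → α) : extendFamily x y f 0 = x := rfl
@[simp] theorem extendFamily_one (f : Fin n → α) : extendFamily x y f 1 = y := rfl
@[simp] theorem extendFamily_shift (f : Fin n → α) (v : Fin n) :
    extendFamily x y f (shift v) = f v := rfl

theorem extendMatrix_mem {x y z : α} {s : Set α} (hx : x ∈ s) (hy : y ∈ s) (hz : z ∈ s)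
    {f : Fin n × Fin n → α} (hf : ∀ e, f e ∈ s) (e : Fin (n + 2) × Fin (n + 2)) :
    extendMatrix x y z f e ∈ s := by
  obtain ⟨u, v⟩ := e
  cases u using voter_cases <;> cases v using voter_cases <;> simp [extendMatrix, *]

theorem update_extendMatrix (x' : α) (f : Fin n × Fin n → α) :
    Function.update (extendMatrix x y z f) (0, 1) x' = extendMatrix x' y z f := by
  funext ⟨u, v⟩
  cases u using voter_cases <;> cases v using voter_cases <;> simp [extendMatrix]

end

/-- The pairs of old voters in a set of pairs of voters. -/
noncomputable def restrictEdges {n : ℕ} (L : Finset (Fin (n + 2) × Fin (n + 2))) :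
    Finset (Fin n × Fin n) :=
  L.preimage shiftPair shiftPair.injective.injOn

/-- The set of all `(1, v)` with an old voter `v` and of the pairs in `L`, together with `(0, 1)`
if `x` is true. -/
def extendEdges {n : ℕ} (x : Bool) (L : Finset (Fin n × Fin n)) :
    Finset (Fin (n + 2) × Fin (n + 2)) :=
  Finset.univ.filter fun e => extendMatrix x true false (fun e => decide (e ∈ L)) e

section
variable {n : ℕ}

@[simp] theorem mem_restrictEdges {L : Finset (Fin (n + 2) × Fin (n + 2))} {e : Fin n × Fin n} :
    e ∈ restrictEdges L ↔ shiftPair e ∈ L :=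
  Finset.mem_preimage

theorem restrictEdges_map_shiftPair (L : Finset (Fin n × Fin n)) :
    restrictEdges (L.map shiftPair) = L :=
  Finset.preimage_map _ _

theorem restrictEdges_inter (A H : Finset (Fin (n + 2) × Fin (n + 2))) :
    restrictEdges (A ∩ H) = restrictEdges A ∩ restrictEdges H :=
  Finset.preimage_inter (fun _ _ _ _ h => shiftPair.injective h)
    fun _ _ _ _ h => shiftPair.injective h

theorem card_restrictEdges_le (L : Finset (Fin (n + 2) × Fin (n + 2))) :
    (restrictEdges L).card ≤ L.card :=
  Finset.card_le_card_of_injOn shiftPair (fun _ => mem_restrictEdges.1)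
    shiftPair.injective.injOn

theorem mem_extendEdges {x : Bool} {L : Finset (Fin n × Fin n)}
    {e : Fin (n + 2) × Fin (n + 2)} :
    e ∈ extendEdges x L ↔ extendMatrix x true false (fun e => decide (e ∈ L)) e = true := by
  simp [extendEdges]

@[simp] theorem shiftPair_mem_extendEdges {x : Bool} {L : Finset (Fin n × Fin n)}
    {e : Fin n × Fin n} : shiftPair e ∈ extendEdges x L ↔ e ∈ L := by
  obtain ⟨u, v⟩ := e
  simp [mem_extendEdges, extendMatrix]

@[simp] theorem restrictEdges_extendEdges (x : Bool) (L : Finset (Fin n × Fin n)) :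
    restrictEdges (extendEdges x L) = L := by
  ext e
  simp only [mem_restrictEdges, shiftPair_mem_extendEdges]

theorem extendEdges_injective (x : Bool) : Function.Injective (extendEdges (n := n) x) :=
  Function.LeftInverse.injective (restrictEdges_extendEdges x)

end

/-- No pair in `L` starts at voter `0` or leads from an old voter to a new one, so that messages
spread along `L` from an old voter as they do along `restrictEdges L`. -/
def Separated {n : ℕ} (L : Finset (Fin (n + 2) × Fin (n + 2))) : Prop :=
  (∀ w, (0, w) ∉ L) ∧ ∀ u, (shift u, 0) ∉ L ∧ (shift u, 1) ∉ L

namespace Separated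
variable {n : ℕ} {L : Finset (Fin (n + 2) × Fin (n + 2))}

theorem mono {L' : Finset (Fin (n + 2) × Fin (n + 2))} (h : Separated L) (hL : L' ⊆ L) :
    Separated L' :=
  ⟨fun w hw => h.1 w (hL hw), fun u => ⟨fun hu => (h.2 u).1 (hL hu), fun hu => (h.2 u).2 (hL hu)⟩⟩

theorem extendEdges_false (H : Finset (Fin n × Fin n)) : Separated (extendEdges false H) := by
  refine ⟨fun w => ?_, fun u => ?_⟩
  · cases w using voter_cases <;> simp [mem_extendEdges, extendMatrix]
  · simp [mem_extendEdges, extendMatrix]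

theorem influenced_zero_iff (h : Separated L) {w : Fin (n + 2)} : Influenced L 0 w ↔ w = 0 := by
  rw [influenced_iff_reflTransGen, Relation.reflTransGen_iff_eq h.1]

theorem influenced_shift_iff (h : Separated L) {s : Fin n} {w : Fin (n + 2)} :
    Influenced L (shift s) w ↔ ∃ v, w = shift v ∧ Influenced (restrictEdges L) s v := by
  simp only [influenced_iff_reflTransGen]
  constructor
  · intro hw
    induction hw with
    | refl => exact ⟨s, rfl, .refl⟩
    | @tail b c _ hbc ih =>
      obtain ⟨v, rfl, hv⟩ := ih
      cases c using voter_cases with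
      | zero => exact absurd hbc (h.2 v).1
      | one => exact absurd hbc (h.2 v).2
      | old c => exact ⟨c, rfl, hv.tail (mem_restrictEdges.2 hbc)⟩
  · rintro ⟨v, rfl, hv⟩
    exact hv.lift shift fun _ _ => mem_restrictEdges.1

end Separated

/-! ### Gains and margins of victory -/

theorem le_sup'_sub_inf'_of_injective {m : ℕ} {f : Fin (m + 1) → ℕ} (hf : f.Injective) :
    m ≤ Finset.univ.sup' Finset.univ_nonempty f - Finset.univ.inf' Finset.univ_nonempty f := by
  have h := Finset.card_le_card_of_injOn (s := Finset.univ)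
    (t := Finset.Icc (Finset.univ.inf' Finset.univ_nonempty f)
      (Finset.univ.sup' Finset.univ_nonempty f)) f
    (fun i hi => Finset.mem_coe.2 (Finset.mem_Icc.2 ⟨Finset.inf'_le _ hi, Finset.le_sup' _ hi⟩))
    hf.injOn
  rw [Finset.card_univ, Fintype.card_fin, Nat.card_Icc] at h
  omega

namespace Instance

/-- The largest score, which determines the tie-breaking parameter `eps`. -/
def maxScore (I : Instance) : ℕ := Finset.univ.sup fun v => Finset.univ.sup fun i => I.score v i

section
variable (I : Instance)

theorem score_le_maxScore (v : Fin I.n) (i : Fin (I.ℓ + 1)) : I.score v i ≤ I.maxScore :=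
  (Finset.le_sup (f := I.score v) (Finset.mem_univ i)).trans
    (Finset.le_sup (f := fun v => Finset.univ.sup (I.score v)) (Finset.mem_univ v))

theorem maxScore_le_sum : I.maxScore ≤ ∑ v, ∑ i, I.score v i :=
  Finset.sup_le fun v hv => Finset.sup_le fun _ hi =>
    (Finset.single_le_sum (f := I.score v) (fun _ _ => Nat.zero_le _) hi).trans
      (Finset.single_le_sum (f := fun v => ∑ i, I.score v i) (fun _ _ => Nat.zero_le _) hv)

theorem ℓ_le_spread : I.ℓ ≤ I.spread :=
  (le_sup'_sub_inf'_of_injective (I.score_injective ⟨0, I.n_pos⟩)).trans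
    (Finset.le_sup (f := fun v => Finset.univ.sup' Finset.univ_nonempty (I.score v) -
      Finset.univ.inf' Finset.univ_nonempty (I.score v)) (Finset.mem_univ _))

theorem spread_le_maxScore : I.spread ≤ I.maxScore :=
  Finset.sup_le fun v _ =>
    (Nat.sub_le _ _).trans (Finset.sup'_le _ _ fun i _ => I.score_le_maxScore v i)

theorem ℓ_le_maxScore : I.ℓ ≤ I.maxScore := I.ℓ_le_spread.trans I.spread_le_maxScore

theorem eps_eq : I.eps = 1 / (1 + (I.maxScore : ℚ)) := rfl

theorem eps_pos : 0 < I.eps := by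
  rw [eps_eq]; positivity

theorem eps_lt_one : I.eps < 1 := by
  have h : (0 : ℚ) < I.maxScore := by exact_mod_cast I.ℓ_pos.trans_le I.ℓ_le_maxScore
  rw [eps_eq, div_lt_one (by positivity)]
  linarith

theorem sum_natAbs_news_lt (v : Fin I.n) : ∑ i, (I.news v i).natAbs <
    2 ^ (Data.ofOption ((I.message v).map fun m => Data.ofFamily fun i =>
      Data.ofInt (m i))).size := by
  unfold news
  cases I.message v with
  | none => simp
  | some m =>
    refine (Data.sum_lt_two_pow_size_ofFamily fun i =>
      Data.natAbs_lt_two_pow_size_ofInt (m i)).trans_le (Nat.pow_le_pow_right two_pos ?_)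
    simp only [Option.map_some, Data.ofOption, Data.size_cons]
    omega

theorem maxScore_add_sum_natAbs_news_lt :
    I.maxScore + ∑ s, ∑ i, (I.news s i).natAbs < 2 ^ I.size :=
  calc I.maxScore + ∑ s, ∑ i, (I.news s i).natAbs
    _ ≤ ∑ v, (∑ i, I.score v i + ∑ i, (I.news v i).natAbs) := by
        rw [Finset.sum_add_distrib]
        exact Nat.add_le_add_right I.maxScore_le_sum _
    _ < 2 ^ I.encode.left.size :=
        Data.sum_lt_two_pow_size_ofFamily fun v => Data.add_lt_two_pow_size_cons
          (Data.sum_lt_two_pow_size_ofFamily fun _ => Data.lt_two_pow_size_ofNat _)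
          (I.sum_natAbs_news_lt v)
    _ ≤ 2 ^ I.size := Nat.pow_le_pow_right two_pos (Data.size_left_le I.encode)

variable {I} in
theorem abs_sum_news_add_abs_sum_news_le {i j : Fin (I.ℓ + 1)} (hij : i ≠ j)
    (S : Finset (Fin I.n)) :
    |∑ s ∈ S, I.news s i| + |∑ s ∈ S, I.news s j| ≤ ∑ s, ∑ i, |I.news s i| :=
  calc |∑ s ∈ S, I.news s i| + |∑ s ∈ S, I.news s j|
    _ ≤ ∑ s ∈ S, |I.news s i| + ∑ s ∈ S, |I.news s j| :=
        add_le_add (Finset.abs_sum_le_sum_abs _ _) (Finset.abs_sum_le_sum_abs _ _)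
    _ = ∑ s ∈ S, ∑ i ∈ {i, j}, |I.news s i| := by
        simp only [Finset.sum_pair hij, Finset.sum_add_distrib]
    _ ≤ ∑ s ∈ S, ∑ i, |I.news s i| := Finset.sum_le_sum fun s _ =>
        Finset.sum_le_univ_sum_of_nonneg fun _ => abs_nonneg _
    _ ≤ ∑ s, ∑ i, |I.news s i| :=
        Finset.sum_le_univ_sum_of_nonneg fun _ => Finset.sum_nonneg fun _ _ => abs_nonneg _

variable {I} in
theorem maxScore_add_sum_news_lt {i j : Fin (I.ℓ + 1)} (hij : i ≠ j) (S : Finset (Fin I.n)) :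
    (I.maxScore : ℤ) + ∑ s ∈ S, I.news s i < 2 ^ I.size + ∑ s ∈ S, I.news s j := by
  have hsize : (I.maxScore : ℤ) + ∑ s, ∑ i, |I.news s i| < 2 ^ I.size := by
    have := I.maxScore_add_sum_natAbs_news_lt
    zify at this
    exact this
  have habs := abs_sum_news_add_abs_sum_news_le hij S
  have hi := le_abs_self (∑ s ∈ S, I.news s i)
  have hj := neg_abs_le (∑ s ∈ S, I.news s j)
  linarith

theorem mov_le (A H : Finset (Fin I.n × Fin I.n)) : I.mov A H ≤ I.n := by
  have := Finset.card_le_univ (I.votersFor (A ∩ H) 0)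
  rw [Fintype.card_fin] at this
  unfold mov
  omega

variable {I} in
theorem mov_eq_of_forall_lt {A H : Finset (Fin I.n × Fin I.n)}
    (h : ∀ v j, j ≠ 0 → I.finalScore (A ∩ H) v j < I.finalScore (A ∩ H) v 0) :
    I.mov A H = I.n := by
  have h0 : I.votersFor (A ∩ H) 0 = Finset.univ :=
    Finset.filter_true_of_mem fun v _ => h v
  have hc : ((Finset.univ.filter fun c : Fin (I.ℓ + 1) => c ≠ 0).sup
      fun c => (I.votersFor (A ∩ H) c).card) = 0 := by
    refine (Finset.sup_eq_bot_iff _ _).2 fun c hc => Finset.card_eq_zero.2 ?_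
    have hc : c ≠ 0 := (Finset.mem_filter.1 hc).2
    exact Finset.filter_false_of_mem fun v _ hv => lt_asymm (h v c hc) (hv 0 hc.symm)
  simp [mov, h0, hc]

theorem liveProb_nonneg (H : Finset (Fin I.n × Fin I.n)) : 0 ≤ I.liveProb H := by
  refine Finset.prod_nonneg fun e _ => ?_
  split_ifs
  · exact I.prob_nonneg e
  · exact sub_nonneg.2 (I.prob_le_one e)

variable {I}

theorem mem_of_liveProb_ne_zero {H : Finset (Fin I.n × Fin I.n)} (hH : I.liveProb H ≠ 0)
    {e : Fin I.n × Fin I.n} (he : I.prob e = 1) : e ∈ H := by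
  by_contra h
  exact Finset.prod_ne_zero_iff.1 hH e (Finset.mem_univ e) (by rw [if_neg h, he, sub_self])

theorem notMem_of_liveProb_ne_zero {H : Finset (Fin I.n × Fin I.n)} (hH : I.liveProb H ≠ 0)
    {e : Fin I.n × Fin I.n} (he : I.prob e = 0) : e ∉ H := fun h =>
  Finset.prod_ne_zero_iff.1 hH e (Finset.mem_univ e) (by rw [if_pos h, he])

variable (I) (k : Modification)

theorem feasible_empty : I.Feasible k ∅ := by
  cases k <;> simp [Feasible]

theorem modify_empty : I.modify ∅ k = I.edges := by
  cases k <;> simp [modify]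

theorem gain_empty : I.gain k ∅ = 0 := by
  simp [gain, modify_empty]

variable {I k}

theorem IsApprox.gain_nonneg {ρ : NNReal} {F : Finset (Fin I.n × Fin I.n)}
    (h : I.IsApprox k ρ F) : (0 : ℝ) ≤ I.gain k F := by
  have := h.2 ∅ (I.feasible_empty k)
  rwa [gain_empty, Rat.cast_zero, mul_zero] at this

theorem isOptimal_empty_of_mov_eq (h : ∀ H, I.liveProb H ≠ 0 → I.mov I.edges H = I.n) :
    I.IsOptimal k ∅ := by
  refine ⟨feasible_empty _ k, fun F _ => ?_⟩
  rw [gain_empty]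
  refine Finset.sum_nonpos fun H _ => ?_
  by_cases hH : I.liveProb H = 0
  · rw [hH, zero_mul]
  · refine mul_nonpos_of_nonneg_of_nonpos (I.liveProb_nonneg H) (Int.cast_nonpos.2 ?_)
    rw [h H hH]
    exact sub_nonpos.2 (I.mov_le _ H)

end

end Instance

/-! ### The extended instance -/

namespace Instance

/-- The instance `I` with two more voters `0` and `1`, who prefer `c_0`. Voter `0` is a seed whose
message makes everybody it reaches vote for `c_0`: its weight exceeds all numbers in `I`. It can
reach the old voters through voter `1` only, who influences all of them with certainty, and it
reaches voter `1` with probability `p`. The scores of `0` and `1` increase neither the spread nor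
the largest score. -/
abbrev extend (I : Instance) (p : Set.Icc (0 : ℚ) 1) : Instance where
  n := I.n + 2
  n_pos := by omega
  ℓ := I.ℓ
  ℓ_pos := I.ℓ_pos
  score := extendFamily (fun i => I.ℓ - i) (fun i => I.ℓ - i) I.score
  score_injective := by
    have h : Function.Injective fun i : Fin (I.ℓ + 1) => I.ℓ - (i : ℕ) := by
      intro i j hij
      simp only at hij
      omega
    exact voter_cases h h I.score_injective
  message := extendFamily (some fun i => if i = 0 then 2 ^ I.size else 0) none I.message
  edges := extendEdges true I.edges
  prob := extendMatrix (p : ℚ) 1 0 I.prob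
  prob_nonneg e := (extendMatrix_mem (s := Set.Icc 0 1) p.2 (by simp) (by simp)
    (fun e => ⟨I.prob_nonneg e, I.prob_le_one e⟩) e).1
  prob_le_one e := (extendMatrix_mem (s := Set.Icc 0 1) p.2 (by simp) (by simp)
    (fun e => ⟨I.prob_nonneg e, I.prob_le_one e⟩) e).2
  budget := I.budget

variable (I : Instance) (p : Set.Icc (0 : ℚ) 1)

theorem extend_message_shift (v : Fin I.n) : (I.extend p).message (shift v) = I.message v := rfl

theorem extend_news_shift (v : Fin I.n) (i : Fin (I.ℓ + 1)) :
    (I.extend p).news (shift v) i = I.news v i := by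
  unfold news
  rw [extend_message_shift]
  cases I.message v <;> rfl

theorem extend_maxScore : (I.extend p).maxScore = I.maxScore := by
  apply le_antisymm
  · refine Finset.sup_le fun w _ => Finset.sup_le fun i _ => ?_
    have hnew : I.ℓ - (i : ℕ) ≤ I.maxScore := (Nat.sub_le _ _).trans I.ℓ_le_maxScore
    cases w using voter_cases with
    | zero => exact hnew
    | one => exact hnew
    | old v => exact I.score_le_maxScore v i
  · exact Finset.sup_le fun v _ => Finset.sup_le fun i _ =>
      (I.extend p).score_le_maxScore (shift v) i

theorem extend_eps : (I.extend p).eps = I.eps := by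
  rw [eps_eq, eps_eq, extend_maxScore]

theorem extend_spread_le : (I.extend p).spread ≤ I.spread := by
  refine Finset.sup_le fun w _ => ?_
  have hnew : Finset.univ.sup' Finset.univ_nonempty (fun i : Fin (I.ℓ + 1) => I.ℓ - (i : ℕ)) -
      Finset.univ.inf' Finset.univ_nonempty (fun i : Fin (I.ℓ + 1) => I.ℓ - (i : ℕ)) ≤ I.spread :=
    (Nat.sub_le _ _).trans
      ((Finset.sup'_le _ _ fun _ _ => Nat.sub_le _ _).trans I.ℓ_le_spread)
  cases w using voter_cases with
  | zero => exact hnew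
  | one => exact hnew
  | old v => exact Finset.le_sup (f := fun v => Finset.univ.sup' Finset.univ_nonempty (I.score v) -
      Finset.univ.inf' Finset.univ_nonempty (I.score v)) (Finset.mem_univ v)

theorem sameSetting_extend : I.SameSetting (I.extend p) :=
  ⟨rfl, rfl, fun h => voter_cases (fun _ => Nat.sub_le _ _) (fun _ => Nat.sub_le _ _) h⟩

open Classical in
theorem extend_finalScore (L : Finset (Fin (I.n + 2) × Fin (I.n + 2))) (w : Fin (I.n + 2))
    (i : Fin (I.ℓ + 1)) : (I.extend p).finalScore L w i =
      (1 - I.eps) * ((I.extend p).score w i : ℚ) +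
      (((if Influenced L 0 w then if i = 0 then 2 ^ I.size else 0 else 0) +
        ∑ s ∈ Finset.univ.filter (fun s => (I.message s).isSome ∧ Influenced L (shift s) w),
          I.news s i : ℤ) : ℚ) := by
  unfold finalScore
  rw [extend_eps]
  congr 2
  rw [Finset.sum_filter, Finset.sum_filter]
  refine (sum_fin_add_two (n := I.n) _).trans ?_
  congr 1
  · exact if_congr (and_iff_right rfl) rfl rfl
  · rw [if_neg (by simp), zero_add]
    exact Finset.sum_congr rfl fun s _ => if_congr Iff.rfl (I.extend_news_shift p s i) rfl

theorem extend_finalScore_shift {L : Finset (Fin (I.n + 2) × Fin (I.n + 2))} (hL : Separated L)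
    (v : Fin I.n) (i : Fin (I.ℓ + 1)) :
    (I.extend p).finalScore L (shift v) i = I.finalScore (restrictEdges L) v i := by
  classical
  rw [extend_finalScore]
  simp [hL.influenced_zero_iff, hL.influenced_shift_iff, finalScore]

theorem extend_finalScore_lt_of_new {L : Finset (Fin (I.n + 2) × Fin (I.n + 2))}
    (hL : Separated L) {w : Fin (I.n + 2)} (hw : w = 0 ∨ w = 1) {j : Fin (I.ℓ + 1)} (hj : j ≠ 0) :
    (I.extend p).finalScore L w j < (I.extend p).finalScore L w 0 := by
  classical
  have hscore : ∀ i, (I.extend p).score w i = I.ℓ - i := by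
    rcases hw with rfl | rfl <;> exact fun _ => rfl
  have hold : ∀ v, w ≠ shift v := by
    rcases hw with rfl | rfl <;> simp
  have hfinal : ∀ i : Fin (I.ℓ + 1), (I.extend p).finalScore L w i =
      (1 - I.eps) * ((I.ℓ - i : ℕ) : ℚ) + if w = 0 ∧ i = 0 then 2 ^ I.size else 0 := by
    intro i
    rw [extend_finalScore, hscore]
    simp [hL.influenced_zero_iff, hL.influenced_shift_iff, hold, ite_and]
  have hlt : ((I.ℓ - j : ℕ) : ℚ) < ((I.ℓ - (0 : Fin (I.ℓ + 1)) : ℕ) : ℚ) := by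
    have hj' : (j : ℕ) ≠ 0 := Fin.val_ne_zero_iff.2 hj
    have := I.ℓ_pos
    rw [Fin.val_zero]
    exact_mod_cast (by omega)
  calc (I.extend p).finalScore L w j
    _ = (1 - I.eps) * ((I.ℓ - j : ℕ) : ℚ) := by rw [hfinal, if_neg (fun h => hj h.2), add_zero]
    _ < (1 - I.eps) * ((I.ℓ - (0 : Fin (I.ℓ + 1)) : ℕ) : ℚ) :=
        mul_lt_mul_of_pos_left hlt (sub_pos.2 I.eps_lt_one)
    _ ≤ (I.extend p).finalScore L w 0 := by
        refine (le_add_of_nonneg_right ?_).trans_eq (hfinal 0).symm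
        split_ifs <;> positivity

theorem extend_finalScore_lt {L : Finset (Fin (I.n + 2) × Fin (I.n + 2))} {w : Fin (I.n + 2)}
    (hw : Influenced L 0 w) {j : Fin (I.ℓ + 1)} (hj : j ≠ 0) :
    (I.extend p).finalScore L w j < (I.extend p).finalScore L w 0 := by
  classical
  set S := Finset.univ.filter fun s => (I.message s).isSome ∧ Influenced L (shift s) w
  have hfinal : ∀ i : Fin (I.ℓ + 1), (I.extend p).finalScore L w i =
      (1 - I.eps) * ((I.extend p).score w i : ℚ) +
        (((if i = 0 then 2 ^ I.size else 0) + ∑ s ∈ S, I.news s i : ℤ) : ℚ) := by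
    intro i
    rw [extend_finalScore, if_pos hw]
  have hscore : ((I.extend p).score w j : ℚ) ≤ I.maxScore := by
    rw [← I.extend_maxScore p]
    exact_mod_cast (I.extend p).score_le_maxScore w j
  have hnews : (I.maxScore : ℚ) + (∑ s ∈ S, I.news s j : ℤ) <
      (2 ^ I.size + ∑ s ∈ S, I.news s 0 : ℤ) := by
    exact_mod_cast maxScore_add_sum_news_lt hj S
  have heps : 0 ≤ 1 - I.eps := (sub_pos.2 I.eps_lt_one).le
  calc (I.extend p).finalScore L w j
    _ = (1 - I.eps) * ((I.extend p).score w j : ℚ) + (∑ s ∈ S, I.news s j : ℤ) := by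
        rw [hfinal, if_neg hj, zero_add]
    _ ≤ I.maxScore + (∑ s ∈ S, I.news s j : ℤ) := add_le_add_left
        ((mul_le_of_le_one_left (by positivity) (sub_le_self _ I.eps_pos.le)).trans hscore) _
    _ < (2 ^ I.size + ∑ s ∈ S, I.news s 0 : ℤ) := hnews
    _ ≤ (I.extend p).finalScore L w 0 := by
        refine (le_add_of_nonneg_left ?_).trans_eq (hfinal 0).symm
        exact mul_nonneg heps (by positivity)

end Instance

namespace Instance
variable (I : Instance) (p : Set.Icc (0 : ℚ) 1) (k : Modification)

theorem extend_card_votersFor {L : Finset (Fin (I.n + 2) × Fin (I.n + 2))} (hL : Separated L)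
    (c : Fin (I.ℓ + 1)) : ((I.extend p).votersFor L c).card =
      (I.votersFor (restrictEdges L) c).card + if c = 0 then 2 else 0 := by
  classical
  have hnew : ∀ w : Fin (I.n + 2), w = 0 ∨ w = 1 →
      ((∀ j, j ≠ c → (I.extend p).finalScore L w j < (I.extend p).finalScore L w c) ↔
        c = 0) := by
    intro w hw
    constructor
    · intro h
      by_contra hc
      exact lt_asymm (h 0 (Ne.symm hc)) (I.extend_finalScore_lt_of_new p hL hw hc)
    · rintro rfl j hj
      exact I.extend_finalScore_lt_of_new p hL hw hj
  unfold votersFor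
  rw [Finset.card_filter, Finset.card_filter]
  refine (sum_fin_add_two (n := I.n) _).trans ?_
  simp only [hnew 0 (.inl rfl), hnew 1 (.inr rfl), I.extend_finalScore_shift p hL]
  split_ifs <;> ring

theorem extend_mov {A H : Finset (Fin (I.n + 2) × Fin (I.n + 2))} (h : Separated (A ∩ H)) :
    (I.extend p).mov A H = I.mov (restrictEdges A) (restrictEdges H) + 2 := by
  have hcard : ∀ c : Fin (I.ℓ + 1), ((I.extend p).votersFor (A ∩ H) c).card =
      (I.votersFor (restrictEdges A ∩ restrictEdges H) c).card + if c = 0 then 2 else 0 := by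
    rw [← restrictEdges_inter]
    exact I.extend_card_votersFor p h
  have hsup : ((Finset.univ.filter fun c : Fin (I.ℓ + 1) => c ≠ 0).sup
      fun c => ((I.extend p).votersFor (A ∩ H) c).card) =
      (Finset.univ.filter fun c : Fin (I.ℓ + 1) => c ≠ 0).sup
        fun c => (I.votersFor (restrictEdges A ∩ restrictEdges H) c).card :=
    Finset.sup_congr rfl fun c hc => by rw [hcard c, if_neg (Finset.mem_filter.1 hc).2, add_zero]
  simp only [mov, hcard 0, hsup]
  push_cast
  ring

theorem shiftPair_mem_extend_edges {e : Fin I.n × Fin I.n} :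
    shiftPair e ∈ (I.extend p).edges ↔ e ∈ I.edges :=
  shiftPair_mem_extendEdges

theorem restrictEdges_extend_modify (F : Finset (Fin (I.n + 2) × Fin (I.n + 2))) :
    restrictEdges ((I.extend p).modify F k) = I.modify (restrictEdges F) k := by
  ext e
  cases k <;> simp [modify]

theorem extend_zero_liveProb (H : Finset (Fin I.n × Fin I.n)) :
    (I.extend 0).liveProb (extendEdges false H) = I.liveProb H := by
  refine (Fintype.prod_of_injective shiftPair shiftPair.injective _ _ ?_ ?_).symm
  · rintro ⟨u, v⟩ h
    cases u using voter_cases <;> cases v using voter_cases <;>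
    first
    | exact absurd ⟨(_, _), rfl⟩ h
    | simp [mem_extendEdges, extendMatrix]
  · rintro ⟨u, v⟩
    simp [mem_extendEdges, extendMatrix]

theorem extendEdges_restrictEdges_of_liveProb_ne_zero
    {H : Finset (Fin (I.n + 2) × Fin (I.n + 2))} (h : (I.extend 0).liveProb H ≠ 0) :
    extendEdges false (restrictEdges H) = H := by
  ext ⟨u, v⟩
  have hone := mem_of_liveProb_ne_zero (e := (u, v)) h
  have hzero := notMem_of_liveProb_ne_zero (e := (u, v)) h
  cases u using voter_cases <;> cases v using voter_cases <;>
    simp_all [mem_extendEdges, extendMatrix]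

theorem extend_zero_gain (F : Finset (Fin (I.n + 2) × Fin (I.n + 2))) :
    (I.extend 0).gain k F = I.gain k (restrictEdges F) := by
  have hmov : ∀ (A : Finset (Fin (I.n + 2) × Fin (I.n + 2))) (H : Finset (Fin I.n × Fin I.n)),
      (I.extend 0).mov A (extendEdges false H) = I.mov (restrictEdges A) H + 2 := by
    intro A H
    rw [I.extend_mov 0 ((Separated.extendEdges_false H).mono Finset.inter_subset_right),
      restrictEdges_extendEdges]
  refine (Fintype.sum_of_injective (extendEdges (n := I.n) false) (extendEdges_injective _)
    _ _ ?_ ?_).symm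
  · intro H hH
    by_cases h : (I.extend 0).liveProb H = 0
    · exact mul_eq_zero_of_left h _
    · exact absurd ⟨_, I.extendEdges_restrictEdges_of_liveProb_ne_zero h⟩ hH
  · intro H
    rw [hmov, hmov, extend_zero_liveProb, restrictEdges_extend_modify, restrictEdges_extendEdges,
      add_sub_add_right_eq_sub]

variable {I p k}

theorem Feasible.restrictEdges {F : Finset (Fin (I.n + 2) × Fin (I.n + 2))}
    (h : (I.extend p).Feasible k F) : I.Feasible k (restrictEdges F) := by
  refine ⟨?_, le_trans (by exact_mod_cast card_restrictEdges_le F) h.2⟩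
  cases k
  · exact fun e he => (I.shiftPair_mem_extend_edges p).1 (h.1 (mem_restrictEdges.1 he))
  · exact Finset.disjoint_left.2 fun e he hE => Finset.disjoint_left.1 h.1
      (mem_restrictEdges.1 he) ((I.shiftPair_mem_extend_edges p).2 hE)

theorem Feasible.map_shiftPair (p : Set.Icc (0 : ℚ) 1) {F : Finset (Fin I.n × Fin I.n)}
    (h : I.Feasible k F) : (I.extend p).Feasible k (F.map shiftPair) := by
  refine ⟨?_, by rw [Finset.card_map]; exact h.2⟩
  cases k
  · exact Finset.map_subset_iff_subset_preimage.2 fun e he => by simpa using h.1 he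
  · rw [Feasible, Finset.disjoint_left] at h
    rw [Finset.disjoint_left, Finset.forall_mem_map]
    exact fun e he hE => h.1 he ((I.shiftPair_mem_extend_edges p).1 hE)

theorem zero_one_mem_extend_edges :
    ((0, 1) : Fin (I.n + 2) × Fin (I.n + 2)) ∈ (I.extend p).edges := by
  simp [mem_extendEdges, extendMatrix]

theorem one_shift_mem_extend_edges (v : Fin I.n) :
    ((1, shift v) : Fin (I.n + 2) × Fin (I.n + 2)) ∈ (I.extend p).edges := by
  simp [mem_extendEdges, extendMatrix]

theorem influenced_zero_of_liveProb_extend_one_ne_zero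
    {H : Finset (Fin (I.n + 2) × Fin (I.n + 2))} (hH : (I.extend 1).liveProb H ≠ 0)
    (w : Fin (I.n + 2)) : Influenced ((I.extend 1).edges ∩ H) 0 w := by
  have h01 : ((0, 1) : Fin (I.n + 2) × Fin (I.n + 2)) ∈ (I.extend 1).edges ∩ H :=
    Finset.mem_inter.2 ⟨zero_one_mem_extend_edges, mem_of_liveProb_ne_zero hH rfl⟩
  rw [influenced_iff_reflTransGen]
  cases w using voter_cases with
  | zero => exact .refl
  | one => exact .single h01
  | old v =>
    have h1v : ((1, shift v) : Fin (I.n + 2) × Fin (I.n + 2)) ∈ (I.extend 1).edges ∩ H :=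
      Finset.mem_inter.2 ⟨one_shift_mem_extend_edges v, mem_of_liveProb_ne_zero hH rfl⟩
    exact .head h01 (.single h1v)

theorem isOptimal_extend_one : (I.extend 1).IsOptimal k ∅ :=
  isOptimal_empty_of_mov_eq fun _ hH => mov_eq_of_forall_lt fun w _ hj =>
    I.extend_finalScore_lt 1 (influenced_zero_of_liveProb_extend_one_ne_zero hH w) hj

end Instance

/-! ### The reduction -/

namespace Data

/-- Encoding of a pair of voters that is no edge and has probability `0`. -/
def deadPair : Data := cons (ofBool false) (ofRat 0)

/-- Encoding of an edge with probability `1`. -/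
def livePair : Data := cons (ofBool true) (ofRat 1)

/-- The scores of the new voters, computed from the encoding of an instance. The countdown depends
on the number of candidates only, which is read off the scores of the first voter. -/
def newScores (x : Data) : Data := x.left.left.left.countdown

/-- The message of the new seed, computed from the encoding of an instance. -/
def newMessage (x : Data) : Data :=
  cons (cons nil (powTwo x.size)) (x.newScores.right.map fun _ => ofInt 0)

/-- The edges and probabilities of the extended instance, computed from those of an instance. -/
def newMatrix (y : Data) : Data :=
  cons (cons deadPair (cons livePair (y.map fun _ => deadPair)))
    (cons (cons deadPair (cons deadPair (y.map fun _ => livePair)))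
      (y.map fun r => cons deadPair (cons deadPair r)))

/-- The extended instance, computed from the encoding of an instance. -/
def newInstance (x : Data) : Data :=
  cons (cons (cons x.newScores (cons nil x.newMessage)) (cons (cons x.newScores nil) x.left))
    (cons x.right.left.newMatrix x.right.right)

/-- The reoptimization input, computed from the encoding of an instance. The empty solution is
encoded by a zero matrix of the same shape as the matrix of the edges. -/
def newReopt (x : Data) : Data :=
  cons x.newInstance (cons (x.right.left.newMatrix.map fun r => r.map fun _ => nil)
    (cons (cons (ofNat 0) (ofNat 1)) (ofRat 0)))

/-- The matrix without its first two rows and columns. -/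
def minor (x : Data) : Data := x.right.right.map fun r => r.right.right

theorem minor_ofEdges {n : ℕ} (F : Finset (Fin (n + 2) × Fin (n + 2))) :
    (ofEdges F).minor = ofEdges (restrictEdges F) := by
  simp only [minor, ofEdges, ofFamily_add_two, right_cons, map_ofFamily, mem_restrictEdges,
    shiftPair_mk]

end Data

namespace PolyTime

theorem newScores : PolyTime Data.newScores := PolyTime.countdown.comp id.left.left.left

theorem newMessage : PolyTime Data.newMessage :=
  .pair (.pair (.const _) .powTwo_size) (PolyTime.comp (.map (.const _)) newScores.right)

theorem newMatrix : PolyTime Data.newMatrix :=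
  .pair (.pair (.const _) (.pair (.const _) (.map (.const _))))
    (.pair (.pair (.const _) (.pair (.const _) (.map (.const _))))
      (.map (.pair (.const _) (.pair (.const _) id))))

theorem newInstance : PolyTime Data.newInstance :=
  .pair (.pair (.pair newScores (.pair (.const _) newMessage))
      (.pair (.pair newScores (.const _)) id.left))
    (.pair (newMatrix.comp id.right.left) id.right.right)

theorem newReopt : PolyTime Data.newReopt :=
  .pair newInstance
    (.pair (PolyTime.comp (.map (.map (.const _))) (newMatrix.comp id.right.left)) (.const _))

theorem minor : PolyTime Data.minor := (PolyTime.map id.right.right).comp id.right.right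

end PolyTime

namespace Instance
variable (I : Instance)

theorem newScores_encode :
    I.encode.newScores = Data.ofFamily fun i : Fin (I.ℓ + 1) => Data.ofNat (I.ℓ - i) := by
  rw [Data.newScores, encode, Data.left_cons, Data.left_ofFamily I.n_pos, Data.left_cons,
    Data.countdown_ofFamily]

theorem newMessage_encode : I.encode.newMessage =
    Data.ofFamily fun i : Fin (I.ℓ + 1) => Data.ofInt (if i = 0 then 2 ^ I.size else 0) := by
  have hweight : Data.ofInt (2 ^ I.size) = .cons .nil (Data.powTwo I.encode.size) := by
    have h : ¬(2 ^ I.size : ℤ) < 0 := not_lt.2 (by positivity)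
    rw [Data.ofInt, decide_eq_false h, Int.natAbs_pow, ← Data.ofNat_two_pow]
    rfl
  rw [Data.newMessage, newScores_encode, Data.ofFamily_succ, Data.right_cons, Data.map_ofFamily,
    Data.ofFamily_succ, if_pos rfl, hweight]
  simp only [Fin.succ_ne_zero, if_false]

theorem newInstance_encode : I.encode.newInstance = (I.extend 1).encode := by
  rw [Data.newInstance, newScores_encode, newMessage_encode]
  unfold encode
  simp only [Data.left_cons, Data.right_cons]
  congr 2
  · simp only [Data.ofFamily_add_two, extendFamily_zero, extendFamily_one, extendFamily_shift]
    rfl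
  · simp only [Data.newMatrix, Data.map_ofFamily, Data.ofFamily_add_two, mem_extendEdges,
      extendMatrix, extendFamily_zero, extendFamily_one, extendFamily_shift, Bool.decide_eq_true]
    rfl

theorem size_le_size_extend_one : I.size ≤ (I.extend 1).size := by
  have hmatrix : ∀ y : Data, y.size ≤ y.newMatrix.size := by
    intro y
    have h := Data.size_le_size_map (f := fun r => .cons Data.deadPair (.cons Data.deadPair r))
      (fun x => by simp only [Data.size_cons]; omega) y
    simp only [Data.newMatrix, Data.size_cons]
    omega
  obtain ⟨V, E, b, hI⟩ : ∃ V E b, I.encode = .cons V (.cons E b) := ⟨_, _, _, rfl⟩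
  have hE := hmatrix E
  rw [size, size, ← newInstance_encode, hI]
  simp only [Data.newInstance, Data.left_cons, Data.right_cons, Data.size_cons]
  omega

/-- The reoptimization input computed from `I`: the message of the new seed surely reaches
everybody, hence the empty set is optimal, until the edge `(0, 1)` dies. -/
abbrev toReopt : ReoptInstance where
  inst := I.extend 1
  sol := ∅
  edge := ((0, 1) : Fin (I.n + 2) × Fin (I.n + 2))
  newProb := 0
  newProb_nonneg := le_rfl
  newProb_le_one := zero_le_one

theorem newReopt_encode : I.encode.newReopt = I.toReopt.encode := by
  have hmatrix : I.encode.right.left.newMatrix = I.encode.newInstance.right.left := rfl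
  rw [Data.newReopt, hmatrix, newInstance_encode, ReoptInstance.encode]
  congr 2
  simp only [encode, Data.right_cons, Data.left_cons, Data.map_ofFamily, Data.ofEdges,
    Finset.notMem_empty, decide_false]
  rfl

theorem toReopt_modified : I.toReopt.modified = I.extend 0 := by
  simp only [ReoptInstance.modified, update_extendMatrix]
  rfl

theorem toReopt_valid (k : Modification) : I.toReopt.Valid k :=
  ⟨isOptimal_extend_one, zero_one_mem_extend_edges⟩

variable {I}

theorem SpreadBounded.of_le {q : Polynomial ℕ} {I' : Instance} (h : I.SpreadBounded q)
    (hspread : I'.spread ≤ I.spread) (hsize : I.size ≤ I'.size) : I'.SpreadBounded q :=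
  hspread.trans (h.trans (monotone_polynomial_eval q hsize))

theorem IsApprox.of_gain_eq {J : Instance} {k : Modification} {ρ ρ' : NNReal}
    {F : Finset (Fin J.n × Fin J.n)} (hF : J.IsApprox k ρ F) (hρ : ρ' ≤ ρ)
    (hlift : ∀ F', I.Feasible k F' → ∃ G, J.Feasible k G ∧ J.gain k G = I.gain k F')
    {F' : Finset (Fin I.n × Fin I.n)} (hF' : I.Feasible k F') (hgain : I.gain k F' = J.gain k F) :
    I.IsApprox k ρ' F' := by
  refine ⟨hF', fun F'' hF'' => ?_⟩
  obtain ⟨G, hG, hGgain⟩ := hlift F'' hF''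
  rw [hgain, ← hGgain]
  rcases le_total 0 (J.gain k G : ℝ) with h0 | h0
  · exact (mul_le_mul_of_nonneg_right (NNReal.coe_le_coe.2 hρ) h0).trans (hF.2 G hG)
  · exact (mul_nonpos_of_nonneg_of_nonpos ρ'.coe_nonneg h0).trans hF.gain_nonneg

end Instance

/-- The programs `f` and `g` reduce the optimization problem for `I` to the reoptimization input
`R`, within cost `r`: `f` computes `R` from `I`, the values of the feasible solutions of `I` and of
the changed instance are the same, and `g` pulls solutions back to `I`. -/
structure ValueReduction (k : Modification) (f g : Prog) (r : Polynomial ℕ) (I : Instance)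
    (R : ReoptInstance) : Prop where
  runs : f.RunsWithin r I.encode R.encode
  valid : R.Valid k
  pull : ∀ F, R.modified.Feasible k F →
    ∃ F', g.RunsWithin r (.cons I.encode (Data.ofEdges F)) (Data.ofEdges F') ∧
      I.Feasible k F' ∧ I.gain k F' = R.modified.gain k F
  lift : ∀ F', I.Feasible k F' → ∃ F, R.modified.Feasible k F ∧ R.modified.gain k F = I.gain k F'

theorem exists_valueReduction_toReopt :
    ∃ f g r, ∀ k I, ValueReduction k f g r I I.toReopt := by
  obtain ⟨f, rf, hf⟩ := PolyTime.newReopt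
  obtain ⟨g, rg, hg⟩ := PolyTime.minor.comp PolyTime.id.right
  refine ⟨f, g, rf + rg, fun k I => ⟨?_, I.toReopt_valid k, ?_, ?_⟩⟩
  · rw [← I.newReopt_encode]
    exact (hf _).mono fun n => by simp
  · rw [I.toReopt_modified]
    refine fun F hF => ⟨restrictEdges F, ?_, hF.restrictEdges, (I.extend_zero_gain k F).symm⟩
    rw [← Data.minor_ofEdges]
    exact (hg (.cons I.encode (Data.ofEdges F))).mono fun n => by simp
  · rw [I.toReopt_modified]
    refine fun F' hF' => ⟨F'.map shiftPair, hF'.map_shiftPair 0, ?_⟩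
    rw [I.extend_zero_gain, restrictEdges_map_shiftPair]

theorem ReoptApproximable.optApproximable {k : Modification} {f g : Prog} {r : Polynomial ℕ}
    {K K' : Set Instance} {ρ ρ' : ℕ → NNReal} (h : ReoptApproximable k K' ρ)
    (hρ : ∀ n, ∀ m ≤ r.eval n, ρ' n ≤ ρ m)
    (hred : ∀ I ∈ K, ∃ R, ValueReduction k f g r I R ∧ R.inst ∈ K') :
    OptApproximable k K ρ' := by
  obtain ⟨c, r', hc⟩ := h
  let s : Polynomial ℕ := 2 * (1 + .X) + 2 * (r + r'.comp r + 1) + 2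
  refine ⟨.seq (.pair .id (.seq f c)) g, s + r.comp s + 1, fun I hI => ?_⟩
  obtain ⟨R, hR, hK'⟩ := hred I hI
  obtain ⟨F, hF, hrun⟩ := hc R hR.valid hK'
  obtain ⟨F', hg, hF', hgain⟩ := hR.pull F hF.1
  exact ⟨F', hF.of_gain_eq (hρ _ _ hR.runs.size_le) hR.lift hF' hgain,
    ((Prog.RunsWithin.id I.encode).pair (hR.runs.seq hrun)).seq hg⟩

theorem mainTheorem12_general :
    ∃ (f g : Prog) (r : Polynomial ℕ), ∀ (k : Modification) (C : Set Instance),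
      (∀ I ∈ C, ∀ I' : Instance,
        I.SameSetting I' → I'.spread ≤ I.spread → I.size ≤ I'.size → I' ∈ C) →
      (∀ I ∈ C, ∃ R : ReoptInstance,
        f.RunsWithin r I.encode R.encode ∧
        R.Valid k ∧ R.inst ∈ C ∧ I.SameSetting R.inst ∧
        (∀ F, R.modified.Feasible k F →
          ∃ F', g.RunsWithin r (.cons I.encode (Data.ofEdges F)) (Data.ofEdges F') ∧
            I.Feasible k F' ∧ I.gain k F' = R.modified.gain k F) ∧
        (∀ F', I.Feasible k F' →
          ∃ F, R.modified.Feasible k F ∧ R.modified.gain k F = I.gain k F')) ∧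
      (∀ K ⊆ C, ∀ ρ ρ' : ℕ → NNReal, (∀ n, ∀ m ≤ r.eval n, ρ' n ≤ ρ m) →
        ¬ OptApproximable k K ρ' →
        ¬ ReoptApproximable k {I' | I' ∈ C ∧ ∃ I ∈ K, I.SameSetting I'} ρ) := by
  obtain ⟨f, g, r, hred⟩ := exists_valueReduction_toReopt
  refine ⟨f, g, r, fun k C hC => ?_⟩
  have hmem : ∀ I ∈ C, I.toReopt.inst ∈ C := fun I hI =>
    hC I hI _ (I.sameSetting_extend 1) (I.extend_spread_le 1) I.size_le_size_extend_one
  refine ⟨fun I hI => ⟨I.toReopt, (hred k I).runs, (hred k I).valid, hmem I hI,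
    I.sameSetting_extend 1, (hred k I).pull, (hred k I).lift⟩, fun K hK ρ ρ' hρ => mt fun h => ?_⟩
  exact h.optApproximable hρ fun I hI =>
    ⟨I.toReopt, hred k I, hmem I (hK hI), I, hI, I.sameSetting_extend 1⟩

theorem mainTheorem12 (k : Modification) (q : Polynomial ℕ) :
    ∃ (f g : Prog) (r : Polynomial ℕ),
      -- a polynomial-time reduction from optimization to reoptimization that preserves values
      (∀ I : Instance, I.SpreadBounded q →
        ∃ R : ReoptInstance,
          f.RunsWithin r I.encode R.encode ∧
          R.Valid k ∧ R.inst.SpreadBounded q ∧ I.SameSetting R.inst ∧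
          (∀ F, R.modified.Feasible k F →
            ∃ F', g.RunsWithin r (.cons I.encode (Data.ofEdges F)) (Data.ofEdges F') ∧
              I.Feasible k F' ∧ I.gain k F' = R.modified.gain k F) ∧
          (∀ F', I.Feasible k F' →
            ∃ F, R.modified.Feasible k F ∧ R.modified.gain k F = I.gain k F')) ∧
      -- hence inapproximability carries over from optimization to reoptimization
      (∀ (K : Set Instance), (∀ I ∈ K, I.SpreadBounded q) →
        ∀ ρ ρ' : ℕ → NNReal, (∀ n, ∀ m ≤ r.eval n, ρ' n ≤ ρ m) →
          ¬ OptApproximable k K ρ' →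
          ¬ ReoptApproximable k
              {I' | I'.SpreadBounded q ∧ ∃ I ∈ K, I.SameSetting I'} ρ) := by
  obtain ⟨f, g, r, h⟩ := mainTheorem12_general
  exact ⟨f, g, r, h k {I | I.SpreadBounded q} fun _ hI _ _ => hI.of_le⟩
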